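/- For integers $n \ge 0$ let $S_n$ be the set of permutations of $\{1,\dots,n\}$. A permutation $\pi \in S_n$ avoids $132$ if there are no indices $a<b<c$ with $\pi(a)<\pi(c)<\pi(b)$. Let $C_i=\frac{1}{i+1}\binom{2i}{i}$ be the $i$-th Catalan number, and let $M_{k,j}$ be the number of Motzkin paths of length $k$ (paths with steps $(1,1)$, $(1,-1)$, $(1,0)$ from $(0,0)$ to $(k,0)$ that never go below the $x$-axis) having exactly $j$ flat steps $(1,0)$ at level zero, i.e. lying on the $x$-axis. Let $\mathcal{P}_{m,k}$ be the set of compositions of $m$ of length $k$, i.e. of sequences $X=(x_1,\dots,x_k)$ of positive integers with $x_1+\dots+x_k=m$. Theorem. Let $m \ge 3$, $r \ge 0$ and $n = r+3m$. The number of $132$-avoiding permutations $\pi \in S_n$ whose disjoint cycle decomposition consists of exactly $r$ fixed points and $m$ $3$-cycles (and no other cycles) is $$\sum_{k=1}^{m}\ \sum_{\ell=2}^{k+1} 2^{\ell-1}\binom{r+\ell-1}{r}\, M_{k-1,\ell-2}\sum_{X\in\mathcal{P}_{m,k}} C_{x_1}C_{x_2}\cdots C_{x_k}.$$ -/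

import Mathlib

namespace PermPattern

/-- The permutation `π` of `{0, …, n-1}` contains the pattern `σ`: some subsequence of the one-line
notation `π 0, π 1, …, π (n-1)` is in the same relative order as `σ 0, …, σ (k-1)`. -/
def Contains {n k : ℕ} (π : Equiv.Perm (Fin n)) (σ : Equiv.Perm (Fin k)) : Prop :=
  ∃ f : Fin k ↪o Fin n, ∀ i j : Fin k, π (f i) < π (f j) ↔ σ i < σ j

/-- `π` avoids the pattern `σ`. -/
def Avoids {n k : ℕ} (π : Equiv.Perm (Fin n)) (σ : Equiv.Perm (Fin k)) : Prop :=
  ¬ Contains π σ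

/-- The pattern `132`; with values shifted to start at `0` its one-line notation is `0, 2, 1`. -/
def p132 : Equiv.Perm (Fin 3) := Equiv.swap 1 2

/-- The number of `k`-cycles in the cycle form of `π`; fixed points count as `1`-cycles. -/
def numCycles {n : ℕ} (k : ℕ) (π : Equiv.Perm (Fin n)) : ℕ :=
  π.partition.parts.count k

/-- All cycles of `π` (fixed points being `1`-cycles) have length in `S`. -/
def CycleLengthsIn {n : ℕ} (S : Set ℕ) (π : Equiv.Perm (Fin n)) : Prop :=
  ∀ i ∈ π.partition.parts, i ∈ S

/-- The steps of a Motzkin path: `up = (1,1)`, `down = (1,-1)`, `flat = (1,0)`. -/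
inductive MotzkinStep : Type
  | up
  | down
  | flat
  deriving DecidableEq

/-- A Motzkin path: a word in up, down and flat steps that ends at level zero and never goes
below level zero. -/
def IsMotzkinPath (w : List MotzkinStep) : Prop :=
  w.count .up = w.count .down ∧ ∀ i, (w.take i).count .down ≤ (w.take i).count .up

/-- The number of flat steps of a path at level zero, i.e. that are preceded by equally many up
and down steps. -/
def flatsAtLevelZero (w : List MotzkinStep) : ℕ :=
  ((Finset.range w.length).filter fun i =>
    w[i]? = some .flat ∧ (w.take i).count .up = (w.take i).count .down).card

/-- The number of Motzkin paths of length `k` with exactly `j` flats at level zero. -/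
noncomputable def motzkinNumber (k j : ℕ) : ℕ :=
  {w : List MotzkinStep | w.length = k ∧ IsMotzkinPath w ∧ flatsAtLevelZero w = j}.ncard

end PermPattern

namespace PermPattern

open Equiv Equiv.Perm

/-! Name the points of each 3-cycle by size (least `mn`, middle `md`, greatest `ls`), number the
cycles by their middle points, and record for each cycle one of its two directions. Then `π` is
determined by the relative order of the named points and the directions, and avoidance of 132
becomes the list of conditions `Pt.IsGood`. All least points precede every other point, greatest
points occur in the order of the middle points, the least points themselves avoid 132, cycles of
different directions do not interleave, and no fixed point lies between the middle and greatest
point of a cycle. Moreover, if a greatest point separates two middle points, or a middle point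
separates two greatest points, the corresponding least points descend.

The middle and greatest points thus form alternating runs. Let `α p` and `β p` count the runs
completed before the `p`-th middle and greatest point; the former precedes the `q`-th greatest point
iff `α p ≤ β q`. Between consecutive indices each count rises by 0 or 1. Label the gap `down` if
only `α` rises, `up` if only `β` does, `flat` if both do, and leave it unlabelled otherwise. Since
`α ≤ β`, with equality at the end, the labels form a Motzkin path. If it has `k - 1` steps, the
labelled gaps cut the `m` cycles into `k` blocks, that is, a composition of `m`; the least points
descend from block to block and are 132-avoiding within each, which gives the product of Catalan
numbers.

A flat at level zero is exactly a gap where all earlier greatest points precede the next middle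
point. With `ℓ - 2` of them there are `ℓ - 1` components. Each has its own direction, giving `2 ^ (ℓ
- 1)`, and the fixed points fill the `ℓ` slots around the components, giving the binomial
coefficient.

The equivalence with `IsGood` is `Pt.IsArranged.isGood` and `Pt.IsArranged.avoids132`; orders are
matched with data by `Pt.exists_realizes` and `Pt.IsArranged.exists_data`; `ncard_threeCyclePerms`
assembles the bijection. -/

/-- No `x < y < z` has `f x < f z < f y`. -/
def Avoids132 {α β : Type*} [Preorder α] [Preorder β] (f : α → β) : Prop :=
  ∀ x y z, x < y → y < z → f x < f z → ¬ f z < f y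

/-! ### Translation of the pattern and cycle-type conditions -/

theorem avoids_p132_iff {n : ℕ} (π : Perm (Fin n)) : Avoids π p132 ↔ Avoids132 π := by
  have h0 : p132 0 = 0 := by decide
  have h1 : p132 1 = 2 := by decide
  have h2 : p132 2 = 1 := by decide
  constructor
  · intro h x y z hxy hyz hxz' hzy'
    have hxz := hxy.trans hyz
    have hxy' := hxz'.trans hzy'
    apply h
    refine ⟨OrderEmbedding.ofStrictMono ![x, y, z] ?_, ?_⟩
    · intro i j hij
      fin_cases i <;> fin_cases j <;> first | exact absurd hij (by decide) | assumption
    · intro i j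
      change π (![x, y, z] i) < π (![x, y, z] j) ↔ _
      fin_cases i <;> fin_cases j <;>
        simp [h0, h1, h2, hxz', hzy', hxy', hxz'.le, hzy'.le, hxy'.le]
  · rintro h ⟨f, hf⟩
    refine h (f 0) (f 1) (f 2) (f.strictMono (by decide)) (f.strictMono (by decide)) ?_ ?_
    · exact (hf 0 2).2 (by rw [h0, h2]; decide)
    · exact (hf 2 1).2 (by rw [h1, h2]; decide)

theorem ncard_eq_sum_fiber {α ι : Type*} [Finite α] [Fintype ι] (s : Set α) (f : α → ι) :
    s.ncard = ∑ i, {a | a ∈ s ∧ f a = i}.ncard := by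
  classical
  have := Fintype.ofFinite α
  simp only [Set.ncard_eq_toFinset_card']
  rw [Finset.card_eq_sum_card_fiberwise (f := f) (t := Finset.univ) (by simp)]
  refine Finset.sum_congr rfl fun i _ => congrArg Finset.card ?_
  ext a
  simp

theorem numCycles_one {n : ℕ} (π : Perm (Fin n)) : numCycles 1 π + π.support.card = n := by
  have h : (1 : ℕ) ∉ π.cycleType := fun h => by
    have := two_le_of_mem_cycleType h
    omega
  have := Finset.card_le_univ π.support
  simp only [Fintype.card_fin] at this
  rw [numCycles, parts_partition, Multiset.count_add, Multiset.count_eq_zero_of_notMem h,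
    Multiset.count_replicate_self, Fintype.card_fin]
  omega

/-- Once all nontrivial cycles have length 3, the size of the support gives their number, and `n = r
+ 3 * m` gives the number of fixed points. -/
theorem cycle_conditions_iff {n m r : ℕ} (hn : n = r + 3 * m) (π : Perm (Fin n)) :
    (CycleLengthsIn {1, 3} π ∧ numCycles 1 π = r ∧ numCycles 3 π = m) ↔
      (∀ x, π (π (π x)) = x) ∧ π.support.card = 3 * m := by
  have h1 := numCycles_one π
  constructor
  · rintro ⟨hc, hr, -⟩
    refine ⟨fun x => ?_, by omega⟩
    have h3 : π ^ 3 = 1 := by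
      rw [← orderOf_dvd_iff_pow_eq_one, ← lcm_cycleType, Multiset.lcm_dvd]
      intro b hb
      have h2 := two_le_of_mem_cycleType hb
      have := hc b (by rw [parts_partition]; exact Multiset.mem_add.2 (Or.inl hb))
      rcases this with rfl | h
      · omega
      · rw [Set.mem_singleton_iff.1 h]
    simpa [pow_succ] using congrArg (fun f : Perm (Fin n) => f x) h3
  · rintro ⟨h3, hs⟩
    have h3' : π ^ 3 = 1 := by ext x; simp [pow_succ, h3]
    have hall : ∀ b ∈ π.cycleType, b = 3 := fun b hb =>
      ((Nat.dvd_prime Nat.prime_three).1 ((dvd_of_mem_cycleType hb).trans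
        (orderOf_dvd_of_pow_eq_one h3'))).resolve_left
        (by have := two_le_of_mem_cycleType hb; omega)
    have hrep := Multiset.eq_replicate_card.2 hall
    have hcard : Multiset.card π.cycleType = m := by
      have := sum_cycleType π
      rw [hrep, Multiset.sum_replicate, hs, smul_eq_mul] at this
      omega
    refine ⟨?_, by omega, ?_⟩
    · intro b hb
      rw [parts_partition, Multiset.mem_add] at hb
      rcases hb with hb | hb
      · exact Or.inr (hall b hb)
      · exact Or.inl (Multiset.eq_of_mem_replicate hb)
    · rw [numCycles, parts_partition, Multiset.count_add, hrep, Multiset.count_replicate_self,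
        Multiset.count_eq_zero_of_notMem, hcard, add_zero]
      intro h
      have := Multiset.eq_of_mem_replicate h
      omega

/-! ### Skew sums, cuts and Catalan numbers -/

/-- All values of `τ` at the first `t` positions exceed all later values. -/
def Cut {n : ℕ} (τ : Perm (Fin n)) (t : ℕ) : Prop :=
  ∀ p q : Fin n, (p : ℕ) < t → t ≤ (q : ℕ) → τ q < τ p

/-- The skew sum of two permutations. -/
def skewSum {x y : ℕ} (σ : Perm (Fin x)) (ρ : Perm (Fin y)) : Perm (Fin (x + y)) :=
  finSumFinEquiv.symm.trans ((Equiv.sumCongr σ ρ).trans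
    ((Equiv.sumComm _ _).trans (finSumFinEquiv.trans (finCongr (Nat.add_comm y x)))))

@[simp]
theorem skewSum_castAdd {x y : ℕ} (σ : Perm (Fin x)) (ρ : Perm (Fin y)) (i : Fin x) :
    (skewSum σ ρ (Fin.castAdd y i) : ℕ) = y + σ i := by
  simp [skewSum, Nat.add_comm]

@[simp]
theorem skewSum_natAdd {x y : ℕ} (σ : Perm (Fin x)) (ρ : Perm (Fin y)) (i : Fin y) :
    (skewSum σ ρ (Fin.natAdd x i) : ℕ) = ρ i := by
  simp [skewSum]

theorem skewSum_injective {x y : ℕ} :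
    Function.Injective fun s : Perm (Fin x) × Perm (Fin y) => skewSum s.1 s.2 := by
  rintro ⟨σ, ρ⟩ ⟨σ', ρ'⟩ h
  have h' : ∀ i, (skewSum σ ρ i : ℕ) = skewSum σ' ρ' i := fun i => by
    simp only at h
    rw [h]
  refine Prod.ext (Equiv.ext fun i => Fin.ext ?_) (Equiv.ext fun i => Fin.ext ?_)
  · simpa using h' (Fin.castAdd y i)
  · simpa using h' (Fin.natAdd x i)

theorem cut_skewSum {x y : ℕ} (σ : Perm (Fin x)) (ρ : Perm (Fin y)) : Cut (skewSum σ ρ) x := by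
  intro p q hp hq
  induction p using Fin.addCases with
  | right i => simp at hp
  | left i =>
    induction q using Fin.addCases with
    | left j => simp at hq; omega
    | right j =>
      rw [Fin.lt_def, skewSum_castAdd, skewSum_natAdd]
      omega

theorem Cut.exists_skewSum {x y : ℕ} {τ : Perm (Fin (x + y))} (h : Cut τ x) :
    ∃ σ ρ, τ = skewSum σ ρ := by
  have hlow : ∀ i : Fin x, y ≤ (τ (Fin.castAdd y i) : ℕ) := by
    intro i
    -- The `y` later values are distinct and all smaller than this one, so it is at least `y`.
    have : (Finset.univ.image (τ ∘ Fin.natAdd x)) ⊆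
        Finset.Iio (τ (Fin.castAdd y i)) := by
      intro v hv
      obtain ⟨j, -, rfl⟩ := Finset.mem_image.1 hv
      exact Finset.mem_Iio.2 (h _ _ (by simp) (by simp))
    have := Finset.card_le_card this
    rw [Finset.card_image_of_injective _ (τ.injective.comp (Fin.natAdd_injective y x))] at this
    simpa using this
  have hhigh : ∀ j : Fin y, (τ (Fin.natAdd x j) : ℕ) < y := by
    intro j
    have : (Finset.univ.image (τ ∘ Fin.castAdd y)) ⊆
        Finset.Ioi (τ (Fin.natAdd x j)) := by
      intro v hv
      obtain ⟨i, -, rfl⟩ := Finset.mem_image.1 hv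
      exact Finset.mem_Ioi.2 (h _ _ (by simp) (by simp))
    have := Finset.card_le_card this
    rw [Finset.card_image_of_injective _ (τ.injective.comp (Fin.castAdd_injective x y))] at this
    simp at this
    omega
  have hσ : Function.Injective fun i : Fin x =>
      (⟨τ (Fin.castAdd y i) - y, by have := hlow i; omega⟩ : Fin x) := by
    intro i j hij
    have hi := hlow i
    have hj := hlow j
    have : (τ (Fin.castAdd y i) : ℕ) = τ (Fin.castAdd y j) := by
      have := Fin.mk.inj hij
      omega
    exact Fin.castAdd_injective x y (τ.injective (Fin.ext this))
  have hρ : Function.Injective fun j : Fin y =>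
      (⟨τ (Fin.natAdd x j), hhigh j⟩ : Fin y) := by
    intro i j hij
    exact Fin.natAdd_injective y x (τ.injective (Fin.ext (Fin.mk.inj hij)))
  refine ⟨Equiv.ofBijective _ (Finite.injective_iff_bijective.1 hσ),
    Equiv.ofBijective _ (Finite.injective_iff_bijective.1 hρ), ?_⟩
  ext i
  induction i using Fin.addCases with
  | left i => rw [skewSum_castAdd]; simp [hlow]
  | right j => rw [skewSum_natAdd]; simp

/-- In a 132 pattern the last value exceeds the first, so the outer two positions cannot straddle
the cut, and the middle position is then on the same side. -/
theorem avoids132_skewSum {x y : ℕ} (σ : Perm (Fin x)) (ρ : Perm (Fin y)) :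
    Avoids132 (skewSum σ ρ) ↔ Avoids132 σ ∧ Avoids132 ρ := by
  constructor
  · refine fun h => ⟨fun a b c hab hbc hac hcb => ?_, fun a b c hab hbc hac hcb => ?_⟩
    · refine h (Fin.castAdd y a) (Fin.castAdd y b) (Fin.castAdd y c) ?_ ?_ ?_ ?_ <;>
        rw [Fin.lt_def] at * <;> simpa
    · refine h (Fin.natAdd x a) (Fin.natAdd x b) (Fin.natAdd x c) ?_ ?_ ?_ ?_ <;>
        rw [Fin.lt_def] at * <;> simpa
  · rintro ⟨hσ, hρ⟩ a b c hab hbc hac hcb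
    have cut := cut_skewSum σ ρ
    induction a using Fin.addCases with
    | left a =>
      induction c using Fin.addCases with
      | right c => exact absurd hac (cut _ _ (by simp) (by simp)).le.not_gt
      | left c =>
        induction b using Fin.addCases with
        | right b => simp [Fin.lt_def] at hbc; omega
        | left b =>
          simp only [Fin.lt_def, skewSum_castAdd, Fin.val_castAdd, add_lt_add_iff_left]
            at hab hbc hac hcb
          exact hσ a b c hab hbc hac hcb
    | right a =>
      induction b using Fin.addCases with
      | left b => simp [Fin.lt_def] at hab; omega
      | right b =>
        induction c using Fin.addCases with
        | left c => simp [Fin.lt_def] at hbc; omega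
        | right c =>
          simp only [Fin.lt_def, skewSum_natAdd, Fin.val_natAdd, add_lt_add_iff_left]
            at hab hbc hac hcb
          exact hρ a b c hab hbc hac hcb

theorem cut_skewSum_add {x y : ℕ} (σ : Perm (Fin x)) (ρ : Perm (Fin y)) (t : ℕ) :
    Cut (skewSum σ ρ) (x + t) ↔ Cut ρ t := by
  constructor
  · intro h p q hp hq
    have := h (Fin.natAdd x p) (Fin.natAdd x q) (by simpa) (by simpa)
    rwa [Fin.lt_def, skewSum_natAdd, skewSum_natAdd] at this
  · intro h p q hp hq
    induction q using Fin.addCases with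
    | left q => simp at hq; omega
    | right q =>
      induction p using Fin.addCases with
      | left p => exact cut_skewSum σ ρ _ _ (by simp) (by simp)
      | right p =>
        rw [Fin.lt_def, skewSum_natAdd, skewSum_natAdd]
        exact h p q (by simpa using hp) (by simpa using hq)

/-- The nonempty prefix sums of a list. -/
def prefixSums : List ℕ → List ℕ
  | [] => []
  | x :: b => x :: (prefixSums b).map (x + ·)

/-- Permutations avoiding `132` that are cut at all prefix sums of `b`. -/
def cutPerms (n : ℕ) (b : List ℕ) : Set (Perm (Fin n)) :=
  {τ | Avoids132 τ ∧ ∀ t ∈ prefixSums b, Cut τ t}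

theorem cutPerms_cons (x y : ℕ) (b : List ℕ) :
    cutPerms (x + y) (x :: b) =
      (fun s : Perm (Fin x) × Perm (Fin y) => skewSum s.1 s.2) ''
        ((cutPerms x []) ×ˢ (cutPerms y b)) := by
  ext τ
  simp only [cutPerms, prefixSums, List.mem_cons, List.mem_map, Set.mem_image, Set.mem_prod,
    Set.mem_ofPred_eq, Prod.exists, List.not_mem_nil, false_imp_iff, implies_true, and_true]
  constructor
  · rintro ⟨hav, hc⟩
    obtain ⟨σ, ρ, rfl⟩ := (hc x (Or.inl rfl)).exists_skewSum
    rw [avoids132_skewSum] at hav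
    exact ⟨σ, ρ, ⟨hav.1, hav.2, fun t ht =>
      (cut_skewSum_add σ ρ t).1 (hc _ (Or.inr ⟨t, ht, rfl⟩))⟩, rfl⟩
  · rintro ⟨σ, ρ, ⟨h1, h2, h3⟩, rfl⟩
    refine ⟨(avoids132_skewSum σ ρ).2 ⟨h1, h2⟩, ?_⟩
    rintro t (rfl | ⟨t, ht, rfl⟩)
    · exact cut_skewSum σ ρ
    · exact (cut_skewSum_add σ ρ t).2 (h3 t ht)

theorem ncard_cutPerms_cons (x y : ℕ) (b : List ℕ) :
    (cutPerms (x + y) (x :: b)).ncard = (cutPerms x []).ncard * (cutPerms y b).ncard := by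
  rw [cutPerms_cons, Set.ncard_image_of_injective _ skewSum_injective, Set.ncard_prod]

/-- Extension of a permutation by a new last point, which is fixed. -/
def extendLast {n : ℕ} (σ : Perm (Fin n)) : Perm (Fin (n + 1)) :=
  finSuccEquivLast.trans ((Equiv.optionCongr σ).trans finSuccEquivLast.symm)

@[simp]
theorem extendLast_castSucc {n : ℕ} (σ : Perm (Fin n)) (i : Fin n) :
    extendLast σ i.castSucc = (σ i).castSucc := by
  simp [extendLast]

@[simp]
theorem extendLast_last {n : ℕ} (σ : Perm (Fin n)) :
    extendLast σ (Fin.last n) = Fin.last n := by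
  simp [extendLast]

theorem extendLast_injective {n : ℕ} :
    Function.Injective (extendLast : Perm (Fin n) → Perm (Fin (n + 1))) := by
  intro σ ρ h
  ext i
  have := congrArg (fun f : Perm (Fin (n + 1)) => (f i.castSucc : ℕ)) h
  simpa using this

theorem exists_extendLast {n : ℕ} {τ : Perm (Fin (n + 1))} (h : τ (Fin.last n) = Fin.last n) :
    ∃ σ, τ = extendLast σ := by
  have hne : ∀ i : Fin n, τ i.castSucc ≠ Fin.last n := fun i hi => by
    rw [← h] at hi
    exact (Fin.castSucc_lt_last i).ne (τ.injective hi)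
  have hinj : Function.Injective fun i : Fin n => (τ i.castSucc).castPred (hne i) := by
    intro i j hij
    exact Fin.castSucc_injective n (τ.injective (Fin.castPred_inj.1 hij))
  refine ⟨Equiv.ofBijective _ (Finite.injective_iff_bijective.1 hinj), ?_⟩
  ext i
  induction i using Fin.lastCases with
  | last => simp [h]
  | cast i => simp

theorem avoids132_extendLast {n : ℕ} (σ : Perm (Fin n)) :
    Avoids132 (extendLast σ) ↔ Avoids132 σ := by
  constructor
  · refine fun h a b c hab hbc hac hcb => ?_
    exact h a.castSucc b.castSucc c.castSucc (by simpa) (by simpa) (by simpa) (by simpa)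
  · refine fun h a b c hab hbc hac hcb => ?_
    induction c using Fin.lastCases with
    | last => exact (Fin.le_last _).not_gt (by simpa using hcb)
    | cast c =>
      induction b using Fin.lastCases with
      | last => exact (Fin.le_last _).not_gt hbc
      | cast b =>
        induction a using Fin.lastCases with
        | last => exact (Fin.le_last _).not_gt hab
        | cast a => exact h a b c (by simpa using hab) (by simpa using hbc) (by simpa using hac)
                      (by simpa using hcb)

/-- An entry before the maximum and a larger one after it would form 132 with the maximum, so there
is a cut just after the maximum. This is the term of the Catalan recursion for a given position of
the maximum. -/
theorem ncard_avoids_maxAt {n i k : ℕ} (hn : i + 1 + k = n) :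
    {τ : Perm (Fin n) | Avoids132 τ ∧
      ∀ a : Fin n, (a : ℕ) = i → (τ a : ℕ) = i + k}.ncard =
      (cutPerms i []).ncard * (cutPerms k []).ncard := by
  subst hn
  have : {τ : Perm (Fin (i + 1 + k)) | Avoids132 τ ∧
      ∀ a : Fin (i + 1 + k), (a : ℕ) = i → (τ a : ℕ) = i + k} =
      (fun s : Perm (Fin i) × Perm (Fin k) => skewSum (extendLast s.1) s.2) ''
        ((cutPerms i []) ×ˢ (cutPerms k [])) := by
    ext τ
    simp only [cutPerms, prefixSums, Set.mem_image, Set.mem_prod,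
      Set.mem_ofPred_eq, Prod.exists, List.not_mem_nil, false_imp_iff, implies_true, and_true]
    constructor
    · rintro ⟨hav, hmax⟩
      have hcut : Cut τ (i + 1) := by
        intro p q hp hq
        by_contra hlt
        have hpq : p ≠ q := fun h => by subst h; omega
        have hpq' : τ p < τ q := lt_of_le_of_ne (not_lt.1 hlt) (τ.injective.ne hpq)
        let a : Fin (i + 1 + k) := ⟨i, by omega⟩
        have ha : (τ a : ℕ) = i + k := hmax a rfl
        have hqa : τ q < τ a := by
          refine lt_of_le_of_ne (Fin.le_def.2 (by omega)) (τ.injective.ne ?_)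
          intro h
          have := congrArg Fin.val h
          simp only [a] at this
          omega
        have hpa : p ≠ a := fun h => by
          rw [h] at hpq'
          exact absurd hpq' hqa.le.not_gt
        have hpi : (p : ℕ) ≠ i := fun h => hpa (Fin.ext h)
        exact hav p a q (Fin.lt_def.2 (by simp only [a]; omega))
          (Fin.lt_def.2 (by simp only [a]; omega)) hpq' hqa
      obtain ⟨σ, ρ, rfl⟩ := hcut.exists_skewSum
      have hl : σ (Fin.last i) = Fin.last i := by
        have := hmax (Fin.castAdd k (Fin.last i)) (by simp)
        rw [skewSum_castAdd] at this
        exact Fin.ext (by simp; omega)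
      obtain ⟨σ, rfl⟩ := exists_extendLast hl
      rw [avoids132_skewSum, avoids132_extendLast] at hav
      exact ⟨σ, ρ, hav, rfl⟩
    · rintro ⟨σ, ρ, h, rfl⟩
      rw [avoids132_skewSum, avoids132_extendLast]
      refine ⟨h, fun a ha => ?_⟩
      have : a = Fin.castAdd k (Fin.last i) := Fin.ext (by simpa using ha)
      rw [this, skewSum_castAdd, extendLast_last]
      simp
      omega
  rw [this, Set.ncard_image_of_injective, Set.ncard_prod]
  rintro ⟨σ, ρ⟩ ⟨σ', ρ'⟩ h
  have := Prod.ext_iff.1 (@skewSum_injective (i + 1) k (extendLast σ, ρ) (extendLast σ', ρ') h)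
  exact Prod.ext (extendLast_injective this.1) this.2

theorem ncard_cutPerms_nil (n : ℕ) : (cutPerms n []).ncard = catalan n := by
  induction n using Nat.strong_induction_on with
  | _ n ih =>
    cases n with
    | zero =>
      have : cutPerms 0 [] = {1} := by
        ext τ
        simp [cutPerms, prefixSums, Subsingleton.elim τ 1, Avoids132]
      simp [this]
    | succ n =>
      rw [ncard_eq_sum_fiber (cutPerms (n + 1) []) fun τ => τ.symm (Fin.last n), catalan_succ]
      refine Finset.sum_congr rfl fun i _ => ?_
      rw [← ih i (by omega), ← ih (n - i) (by omega),
        ← ncard_avoids_maxAt (show (i : ℕ) + 1 + (n - i) = n + 1 by omega)]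
      congr 1
      ext τ
      simp only [cutPerms, prefixSums, Set.mem_ofPred_eq, List.not_mem_nil, false_imp_iff,
        implies_true, and_true, Equiv.symm_apply_eq]
      refine and_congr_right fun _ => ⟨?_, fun h => ?_⟩
      · rintro h a ha
        rw [Fin.ext ha, ← h, Fin.val_last]
        omega
      · rw [eq_comm, Fin.ext_iff, h i rfl, Fin.val_last]
        omega

theorem ncard_cutPerms (b : List ℕ) :
    (cutPerms b.sum b).ncard = (b.map catalan).prod := by
  induction b with
  | nil => simp [ncard_cutPerms_nil]
  | cons x b ih =>
    rw [List.sum_cons, ncard_cutPerms_cons, ih, ncard_cutPerms_nil, List.map_cons, List.prod_cons]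

/-! ### Gap words as compositions with a word of labels -/

/-- The lengths of the blocks into which a row of `g.length + 1` points is divided by separators at
the gaps with a label in `g`. -/
def blocks {α : Type*} : List (Option α) → List ℕ
  | [] => [1]
  | none :: g => (blocks g).modifyHead (· + 1)
  | some _ :: g => 1 :: blocks g

section

variable {α : Type*}

theorem exists_blocks_eq_cons (g : List (Option α)) : ∃ x b, blocks g = (x + 1) :: b := by
  induction g with
  | nil => exact ⟨0, [], rfl⟩
  | cons a g ih =>
    obtain ⟨x, b, h⟩ := ih
    cases a with
    | none => exact ⟨x + 1, b, by simp [blocks, h]⟩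
    | some a => exact ⟨0, (x + 1) :: b, by simp [blocks, h]⟩

theorem sum_blocks (g : List (Option α)) : (blocks g).sum = g.length + 1 := by
  induction g with
  | nil => rfl
  | cons a g ih =>
    cases a with
    | none =>
      obtain ⟨x, b, h⟩ := exists_blocks_eq_cons g
      simp [blocks, h] at ih ⊢
      omega
    | some a => simp [blocks, ih]; omega

theorem length_blocks (g : List (Option α)) :
    (blocks g).length = g.reduceOption.length + 1 := by
  induction g with
  | nil => rfl
  | cons a g ih =>
    cases a with
    | none => simpa [blocks] using ih
    | some a => simpa [blocks] using ih

theorem pos_of_mem_blocks (g : List (Option α)) : ∀ x ∈ blocks g, 0 < x := by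
  induction g with
  | nil => simp [blocks]
  | cons a g ih =>
    cases a with
    | none =>
      obtain ⟨x, b, h⟩ := exists_blocks_eq_cons g
      simp [blocks, h] at ih ⊢
      exact ih
    | some a => simpa [blocks] using ih

theorem blocks_reduceOption_injective {g g' : List (Option α)} (h : blocks g = blocks g')
    (h' : g.reduceOption = g'.reduceOption) : g = g' := by
  induction g generalizing g' with
  | nil =>
    rcases g' with - | ⟨- | a, g'⟩
    · rfl
    · obtain ⟨x, b, hb⟩ := exists_blocks_eq_cons g'
      simp [blocks, hb] at h
    · simp at h'
  | cons a g ih =>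
    obtain ⟨x, b, hb⟩ := exists_blocks_eq_cons g
    rcases g' with - | ⟨a', g'⟩
    · cases a
      · simp [blocks, hb] at h
      · simp at h'
    · obtain ⟨x', b', hb'⟩ := exists_blocks_eq_cons g'
      cases a <;> cases a'
      · simp [blocks, hb, hb'] at h
        rw [ih (g' := g') (by rw [hb, hb', h.1, h.2]) h']
      · simp [blocks, hb, hb'] at h
      · simp [blocks, hb, hb'] at h
      · simp [blocks] at h
        simp at h'
        rw [h'.1, ih h h'.2]

theorem blocks_replicate_append (c x : ℕ) (b : List ℕ) (g : List (Option α))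
    (h : blocks g = x :: b) : blocks (List.replicate c none ++ g) = (x + c) :: b := by
  induction c with
  | zero => simpa
  | succ c ih => simp [List.replicate_succ, blocks, ih, Nat.add_assoc]

theorem reduceOption_replicate_append (c : ℕ) (g : List (Option α)) :
    (List.replicate c none ++ g).reduceOption = g.reduceOption := by
  simp [List.reduceOption_append]

theorem exists_blocks_reduceOption (b : List ℕ) (w : List α) (hb : ∀ x ∈ b, 0 < x)
    (h : b.length = w.length + 1) : ∃ g, blocks g = b ∧ g.reduceOption = w := by
  induction w generalizing b with
  | nil =>
    obtain ⟨x, rfl⟩ := List.length_eq_one_iff.1 h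
    have : 0 < x := hb x (by simp)
    refine ⟨List.replicate (x - 1) none ++ [], ?_, by rw [reduceOption_replicate_append]; rfl⟩
    rw [blocks_replicate_append _ 1 [] _ rfl]
    congr 1
    omega
  | cons a w ih =>
    obtain ⟨x, b, rfl⟩ := List.exists_cons_of_length_eq_add_one h
    have : 0 < x := hb x (by simp)
    obtain ⟨g, hg, hw⟩ := ih b (fun y hy => hb y (by simp [hy])) (by simpa using h)
    refine ⟨List.replicate (x - 1) none ++ some a :: g, ?_, ?_⟩
    · rw [blocks_replicate_append _ 1 b _ (by simp [blocks, hg])]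
      congr 1
      omega
    · rw [reduceOption_replicate_append]
      simp [hw]

theorem prefixSums_modifyHead (b : List ℕ) :
    prefixSums (b.modifyHead (· + 1)) = (prefixSums b).map (· + 1) := by
  cases b with
  | nil => rfl
  | cons x b => simp [prefixSums, Function.comp_def, Nat.add_right_comm]

theorem succ_mem_prefixSums_blocks (g : List (Option α)) (p : ℕ) :
    p + 1 ∈ prefixSums (blocks g) ↔ p = g.length ∨ ∃ a, g[p]? = some (some a) := by
  have h0 : ∀ g : List (Option α), 0 ∉ prefixSums (blocks g) := by
    intro g
    obtain ⟨x, b, h⟩ := exists_blocks_eq_cons g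
    simp [h, prefixSums]
  induction g generalizing p with
  | nil => simp [blocks, prefixSums]
  | cons a g ih =>
    cases a with
    | none =>
      rw [blocks, prefixSums_modifyHead]
      cases p with
      | zero => simp [h0]
      | succ p => simpa using ih p
    | some a =>
      rw [blocks, prefixSums]
      cases p with
      | zero => simp
      | succ p => simpa [Nat.add_comm 1] using ih p

/-- The last prefix sum is the total length `n`, where a cut is vacuous; only the labelled gaps
impose a condition. -/
theorem cutPerms_blocks (g : List (Option α)) (n : ℕ) (hn : n = g.length + 1) :
    cutPerms n (blocks g) =
      {τ : Equiv.Perm (Fin n) | Avoids132 τ ∧ ∀ p a, g[p]? = some (some a) → Cut τ (p + 1)} := by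
  ext τ
  refine and_congr_right fun _ => ⟨fun h p a hp => h _ ?_, fun h t ht => ?_⟩
  · exact (succ_mem_prefixSums_blocks g p).2 (Or.inr ⟨a, hp⟩)
  · cases t with
    | zero => intro p q hp; omega
    | succ p =>
      rcases (succ_mem_prefixSums_blocks g p).1 ht with rfl | ⟨a, ha⟩
      · intro p q hp hq
        have := q.2
        omega
      · exact h p a ha

/-- A composition with `k` parts has `k - 1` separators among the `M` gaps. Writing the letters of
`w` on them in order gives a gap word, and every gap word arises once. -/
theorem sum_composition_words [Fintype α] (M : ℕ) (H : List ℕ → List α → ℕ) :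
    ∑ X : Composition (M + 1), ∑ w : List.Vector α (X.length - 1), H X.blocks w.toList =
      ∑ g : List.Vector (Option α) M, H (blocks g.toList) g.toList.reduceOption := by
  rw [← Fintype.sum_sigma'
    (f := fun (X : Composition (M + 1)) (w : List.Vector α (X.length - 1)) => H X.blocks w.toList)]
  symm
  let F : List.Vector (Option α) M → Σ X : Composition (M + 1), List.Vector α (X.length - 1) :=
    fun g => ⟨⟨blocks g.toList, fun {x} hx => pos_of_mem_blocks _ x hx, by
      rw [sum_blocks, g.toList_length]⟩, ⟨g.toList.reduceOption, by
      simp [Composition.length, length_blocks]⟩⟩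
  refine Fintype.sum_bijective F ⟨?_, ?_⟩ _ _ fun g => rfl
  · have : Function.Injective
        ((fun s : Σ X : Composition (M + 1), List.Vector α (X.length - 1) =>
          (s.1.blocks, s.2.toList)) ∘ F) := by
      intro g g' h
      have := Prod.ext_iff.1 h
      exact Subtype.ext (blocks_reduceOption_injective this.1 this.2)
    exact this.of_comp
  · rintro ⟨⟨b, hb, hs⟩, w, hw⟩
    obtain ⟨g, hg, hgw⟩ := exists_blocks_reduceOption b w (fun x hx => hb hx) (by
      have : b ≠ [] := by rintro rfl; simp at hs
      have := List.length_pos_of_ne_nil this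
      simp only [Composition.length] at hw
      omega)
    subst hg hgw
    exact ⟨⟨g, by rw [sum_blocks] at hs; omega⟩, rfl⟩

end

/-! ### Monotone sequences as multisets -/

/-- The number of weakly increasing sequences of length `r` in `Fin l`. -/
theorem natCard_monotone (l r : ℕ) :
    Nat.card {f : Fin r → Fin l // Monotone f} = (r + l - 1).choose r := by
  -- A monotone sequence is the sorted list of its multiset of values.
  have : Function.Bijective fun f : {f : Fin r → Fin l // Monotone f} =>
      (⟨(List.ofFn f.1 : Multiset (Fin l)), by simp⟩ : Sym (Fin l) r) := by
    constructor
    · rintro ⟨f, hf⟩ ⟨f', hf'⟩ h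
      have hp : (List.ofFn f).Perm (List.ofFn f') :=
        Multiset.coe_eq_coe.1 (congrArg Subtype.val h)
      exact Subtype.ext (List.ofFn_injective (hp.eq_of_sortedLE hf.sortedLE_ofFn
        hf'.sortedLE_ofFn))
    · rintro ⟨s, hs⟩
      have hl : (s.sort (· ≤ ·)).length = r := by simp [hs]
      have hofFn : List.ofFn (fun i : Fin r => (s.sort (· ≤ ·)).get (i.cast hl.symm)) =
          s.sort (· ≤ ·) := List.ext_get (by simp [hl]) (by simp)
      refine ⟨⟨fun i => (s.sort (· ≤ ·)).get (i.cast hl.symm), ?_⟩, ?_⟩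
      · rw [← List.sortedLE_ofFn_iff, hofFn]
        exact List.Pairwise.sortedLE (s.pairwise_sort (· ≤ ·))
      · apply Subtype.ext
        change ((List.ofFn _ : List (Fin l)) : Multiset (Fin l)) = s
        rw [hofFn, Multiset.sort_eq]
  refine (Nat.card_eq_of_bijective _ this).trans ?_
  change Nat.card (Sym (Fin l) r) = _
  rw [Nat.card_eq_fintype_card, Sym.card_sym_fin_eq_multichoose, Nat.multichoose_eq, Nat.add_comm]

/-! ### Naming the points of a permutation made of 3-cycles and fixed points -/

/-- Names for the points of a permutation made of `m` three-cycles and `r` fixed points: the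
least, middle and greatest point of each cycle, and the fixed points. -/
inductive Pt (m r : ℕ) : Type
  | mn (p : Fin m)
  | md (p : Fin m)
  | ls (p : Fin m)
  | fx (j : Fin r)

namespace Pt

variable {n m r : ℕ}

/-- The points as a sum type. -/
def equivSum (m r : ℕ) : Pt m r ≃ (Fin m ⊕ Fin m) ⊕ (Fin m ⊕ Fin r) where
  toFun
    | mn p => .inl (.inl p)
    | md p => .inl (.inr p)
    | ls p => .inr (.inl p)
    | fx j => .inr (.inr j)
  invFun
    | .inl (.inl p) => mn p
    | .inl (.inr p) => md p
    | .inr (.inl p) => ls p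
    | .inr (.inr j) => fx j
  left_inv x := by cases x <;> rfl
  right_inv x := by rcases x with (_ | _) | (_ | _) <;> rfl

instance : Fintype (Pt m r) := Fintype.ofEquiv _ (equivSum m r).symm

theorem card_pt : Fintype.card (Pt m r) = r + 3 * m := by
  rw [Fintype.card_congr (equivSum m r)]
  simp
  omega

/-- The map underlying `rot`. -/
def rotFun (ty : Fin m → Bool) : Pt m r → Pt m r
  | mn p => if ty p then ls p else md p
  | md p => if ty p then mn p else ls p
  | ls p => if ty p then md p else mn p
  | fx j => fx j

theorem rotFun_not_rotFun (ty : Fin m → Bool) (x : Pt m r) :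
    rotFun (fun p => !ty p) (rotFun ty x) = x := by
  rcases x with p | p | p | j
  · cases h : ty p <;> simp [rotFun, h]
  · cases h : ty p <;> simp [rotFun, h]
  · cases h : ty p <;> simp [rotFun, h]
  · rfl

/-- The permutation of the points in which the `p`-th cycle is `mn → ls → md → mn` if `ty p` holds
and `mn → md → ls → mn` otherwise. -/
def rot (ty : Fin m → Bool) : Perm (Pt m r) where
  toFun := rotFun ty
  invFun := rotFun fun p => !ty p
  left_inv := rotFun_not_rotFun ty
  right_inv x := by simpa using rotFun_not_rotFun (fun p => !ty p) x

section rot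

variable (ty : Fin m → Bool)

theorem rot_mn (p : Fin m) : rot ty (mn p : Pt m r) = if ty p then ls p else md p := rfl
theorem rot_md (p : Fin m) : rot ty (md p : Pt m r) = if ty p then mn p else ls p := rfl
theorem rot_ls (p : Fin m) : rot ty (ls p : Pt m r) = if ty p then md p else mn p := rfl
@[simp] theorem rot_fx (j : Fin r) : rot ty (fx j : Pt m r) = fx j := rfl

theorem rot_symm : (rot ty : Perm (Pt m r)).symm = rot fun p => !ty p :=
  Equiv.ext fun _ => rfl

theorem rot_rot_rot (x : Pt m r) : rot ty (rot ty (rot ty x)) = x := by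
  rcases x with p | p | p | j
  · cases h : ty p <;> simp [rot_mn, rot_md, rot_ls, h]
  · cases h : ty p <;> simp [rot_mn, rot_md, rot_ls, h]
  · cases h : ty p <;> simp [rot_mn, rot_md, rot_ls, h]
  · rfl

theorem rot_eq_self_iff (x : Pt m r) : rot ty x = x ↔ ∃ j, x = fx j := by
  rcases x with p | p | p | j
  · cases h : ty p <;> simp [rot_mn, h]
  · cases h : ty p <;> simp [rot_md, h]
  · cases h : ty p <;> simp [rot_ls, h]
  · simp

end rot

/-- The numbering of points `e` respects the order of the names: each cycle has its points in order,
the cycles are numbered by their middle points, and the fixed points are numbered in order. -/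
structure IsArranged (e : Pt m r ≃ Fin n) : Prop where
  mn_lt_md : ∀ p, e (mn p) < e (md p)
  md_lt_ls : ∀ p, e (md p) < e (ls p)
  md_mono : StrictMono fun p => e (md p)
  fx_mono : StrictMono fun j => e (fx j)

/-- `x` lies between its images under `π` and `π ∘ π`. -/
def IsMid (π : Perm (Fin n)) (x : Fin n) : Prop :=
  (π x < x ∧ x < π (π x)) ∨ (π (π x) < x ∧ x < π x)

/-- Each 3-cycle has exactly one point lying between its two images, so the middle points can be
read off from the permutation alone. -/
theorem isMid_permCongr_iff {e : Pt m r ≃ Fin n} (he : IsArranged e) (ty : Fin m → Bool)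
    (x : Fin n) : IsMid (e.permCongr (rot ty)) x ↔ ∃ p, e (md p) = x := by
  obtain ⟨x, rfl⟩ := e.surjective x
  simp only [IsMid, permCongr_apply, symm_apply_apply, EmbeddingLike.apply_eq_iff_eq]
  have h1 := he.mn_lt_md
  have h2 := he.md_lt_ls
  rcases x with p | p | p | j
  · have h3 := (h1 p).trans (h2 p)
    cases h : ty p <;> simp [rot_mn, rot_md, rot_ls, h, (h1 p).not_gt, h3.not_gt]
  · cases h : ty p <;> simp [rot_mn, rot_md, rot_ls, h, h1, h2]
  · have h3 := (h1 p).trans (h2 p)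
    cases h : ty p <;> simp [rot_mn, rot_md, rot_ls, h, (h2 p).not_gt, h3.not_gt]
  · simp

/-- The permutation determines the sets of middle points and of fixed points, and monotonicity
determines their numbering. Whether a middle point is sent down or up gives the direction, and its
orbit gives the other two points. -/
theorem IsArranged.eq_of_permCongr_eq {e e' : Pt m r ≃ Fin n} (he : IsArranged e)
    (he' : IsArranged e') {ty ty' : Fin m → Bool}
    (h : e.permCongr (rot ty) = e'.permCongr (rot ty')) : e = e' ∧ ty = ty' := by
  have hmd : (fun p => e (md p)) = fun p => e' (md p) := by
    rw [← he.md_mono.range_inj he'.md_mono]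
    ext x
    rw [Set.mem_range, Set.mem_range, ← isMid_permCongr_iff he ty, h, isMid_permCongr_iff he' ty']
  have hfx : (fun p => e (fx p)) = fun p => e' (fx p) := by
    have key : ∀ (e : Pt m r ≃ Fin n) (ty : Fin m → Bool) x,
        (∃ j, e (fx j) = x) ↔ e.permCongr (rot ty) x = x := by
      intro e ty x
      obtain ⟨x, rfl⟩ := e.surjective x
      rw [permCongr_apply, symm_apply_apply, EmbeddingLike.apply_eq_iff_eq, rot_eq_self_iff]
      simp [eq_comm]
    rw [← he.fx_mono.range_inj he'.fx_mono]
    ext x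
    rw [Set.mem_range, Set.mem_range, key e ty, key e' ty', h]
  have happ : ∀ p, e (rot ty (md p)) = e' (rot ty' (md p)) := fun p => by
    have := DFunLike.congr_fun h (e (md p))
    rw [permCongr_apply, symm_apply_apply] at this
    rw [this, show e (md p) = e' (md p) from congrFun hmd p, permCongr_apply, symm_apply_apply]
  have happ2 : ∀ p, e (rot ty (rot ty (md p))) = e' (rot ty' (rot ty' (md p))) := fun p => by
    have := DFunLike.congr_fun h (e (rot ty (md p)))
    rw [permCongr_apply, symm_apply_apply] at this
    rw [this, happ, permCongr_apply, symm_apply_apply]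
  have hty : ty = ty' := by
    funext p
    have h1 := happ p
    have h2 : e (md p) = e' (md p) := congrFun hmd p
    have a := he.mn_lt_md p
    have b := he.md_lt_ls p
    have a' := he'.mn_lt_md p
    have b' := he'.md_lt_ls p
    cases ht : ty p <;> cases ht' : ty' p <;> simp [rot_md, ht, ht'] at h1 ⊢ <;> omega
  subst hty
  refine ⟨Equiv.ext fun x => ?_, rfl⟩
  rcases x with p | p | p | j
  · have h1 := happ p
    have h2 := happ2 p
    cases ht : ty p <;>
      simp only [rot_mn, rot_md, rot_ls, ht, if_true, if_false, Bool.false_eq_true] at h1 h2 <;>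
      assumption
  · exact congrFun hmd p
  · have h1 := happ p
    have h2 := happ2 p
    cases ht : ty p <;>
      simp only [rot_mn, rot_md, rot_ls, ht, if_true, if_false, Bool.false_eq_true] at h1 h2 <;>
      assumption
  · exact congrFun hfx j

/-- The support is the disjoint union of the set of middle points and its two translates under `π`.
-/
theorem card_support_eq_three_mul {π : Perm (Fin n)} (h3 : ∀ x, π (π (π x)) = x)
    (s : Finset (Fin n)) (hs : ∀ x, x ∈ s ↔ IsMid π x) : π.support.card = 3 * s.card := by
  have hne : ∀ x, π x ≠ x → π (π x) ≠ x := fun x hx h => hx (by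
    have := h3 x
    rwa [h] at this)
  have hu : π.support = s ∪ (s.map π.toEmbedding ∪ (s.map π.toEmbedding).map π.toEmbedding) := by
    ext x
    simp only [Perm.mem_support, Finset.mem_union, Finset.mem_map_equiv, hs]
    have e1 : π.symm x = π (π x) := by rw [symm_apply_eq, h3]
    have e2 : π.symm (π (π x)) = π x := by rw [symm_apply_eq]
    rw [e1, e2]
    simp only [IsMid, h3]
    have a := hne x
    have b : π (π x) = π x → π x = x := fun h => π.injective h
    constructor
    · intro hx
      have a := a hx
      have b : π (π x) ≠ π x := fun h => hx (b h)
      omega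
    · rintro h h'
      simp [h'] at h
  have hd1 : Disjoint (s.map π.toEmbedding) ((s.map π.toEmbedding).map π.toEmbedding) := by
    rw [Finset.disjoint_left]
    intro x
    simp only [Finset.mem_map_equiv, hs]
    have e1 : π.symm x = π (π x) := by rw [symm_apply_eq, h3]
    have e2 : π.symm (π (π x)) = π x := by rw [symm_apply_eq]
    rw [e1, e2]
    simp only [IsMid, h3]
    omega
  have hd2 : Disjoint s (s.map π.toEmbedding ∪ (s.map π.toEmbedding).map π.toEmbedding) := by
    rw [Finset.disjoint_left]
    intro x
    simp only [Finset.mem_map_equiv, Finset.mem_union, hs]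
    have e1 : π.symm x = π (π x) := by rw [symm_apply_eq, h3]
    have e2 : π.symm (π (π x)) = π x := by rw [symm_apply_eq]
    rw [e1, e2]
    simp only [IsMid, h3]
    omega
  rw [hu, Finset.card_union_of_disjoint hd2, Finset.card_union_of_disjoint hd1]
  simp only [Finset.card_map]
  omega

theorem exists_isArranged (hn : n = r + 3 * m) {π : Perm (Fin n)} (h3 : ∀ x, π (π (π x)) = x)
    (hs : π.support.card = 3 * m) :
    ∃ (e : Pt m r ≃ Fin n) (ty : Fin m → Bool), IsArranged e ∧ π = e.permCongr (rot ty) := by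
  classical
  obtain ⟨s, hsm⟩ : ∃ s : Finset (Fin n), ∀ x, x ∈ s ↔ IsMid π x :=
    ⟨Finset.univ.filter (IsMid π), by simp⟩
  have hcard : s.card = m := by
    have := card_support_eq_three_mul h3 s hsm
    omega
  have hcard' : π.supportᶜ.card = r := by
    rw [Finset.card_compl, Fintype.card_fin]
    omega
  let mid := s.orderEmbOfFin hcard
  let fix := π.supportᶜ.orderEmbOfFin hcard'
  -- The direction is `true` when the middle point goes to the least one, in agreement with `rot`.
  let ty : Fin m → Bool := fun p => decide (π (mid p) < mid p)
  let f : Pt m r → Fin n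
    | mn p => if ty p then π (mid p) else π (π (mid p))
    | md p => mid p
    | ls p => if ty p then π (π (mid p)) else π (mid p)
    | fx j => fix j
  have hmid : ∀ x, IsMid π x → ∃ p, mid p = x := fun x hx => by
    have : x ∈ Set.range mid := by
      rw [Finset.range_orderEmbOfFin]
      exact (hsm x).2 hx
    exact this
  have hmid' : ∀ p, IsMid π (mid p) := fun p => (hsm _).1 (s.orderEmbOfFin_mem hcard p)
  have hsurj : Function.Surjective f := by
    intro x
    by_cases hx : π x = x
    · have : x ∈ Set.range fix := by
        rw [Finset.range_orderEmbOfFin]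
        simpa using hx
      obtain ⟨j, hj⟩ := this
      exact ⟨fx j, hj⟩
    · have hx2 : π (π x) ≠ x := fun h => hx (by
        have := h3 x
        rwa [h] at this)
      have hx3 : π (π x) ≠ π x := fun h => hx (π.injective h)
      have : IsMid π x ∨ IsMid π (π x) ∨ IsMid π (π (π x)) := by
        simp only [IsMid, h3]
        omega
      rcases this with h | h | h
      · obtain ⟨p, hp⟩ := hmid _ h
        exact ⟨md p, hp⟩
      · obtain ⟨p, hp⟩ := hmid _ h
        cases ht : ty p
        · exact ⟨mn p, by simp [f, ht, hp, h3]⟩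
        · exact ⟨ls p, by simp [f, ht, hp, h3]⟩
      · obtain ⟨p, hp⟩ := hmid _ h
        cases ht : ty p
        · exact ⟨ls p, by simp [f, ht, hp, h3]⟩
        · exact ⟨mn p, by simp [f, ht, hp, h3]⟩
  have hbij : Function.Bijective f :=
    (Fintype.bijective_iff_surjective_and_card f).2 ⟨hsurj, by rw [card_pt, Fintype.card_fin, hn]⟩
  refine ⟨Equiv.ofBijective f hbij, ty, ⟨fun p => ?_, fun p => ?_, mid.strictMono,
    fix.strictMono⟩, ?_⟩
  · change (if ty p then π (mid p) else π (π (mid p))) < mid p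
    have := hmid' p
    simp only [IsMid] at this
    cases ht : ty p
    · have ht' : ¬ π (mid p) < mid p := by simpa [ty] using ht
      simp
      omega
    · simpa [ty] using ht
  · change mid p < (if ty p then π (π (mid p)) else π (mid p))
    have := hmid' p
    simp only [IsMid] at this
    cases ht : ty p
    · have ht' : ¬ π (mid p) < mid p := by simpa [ty] using ht
      simp
      omega
    · have ht' : π (mid p) < mid p := by simpa [ty] using ht
      simp
      omega
  · ext x
    obtain ⟨x, rfl⟩ := (Equiv.ofBijective f hbij).surjective x
    rw [permCongr_apply, symm_apply_apply, ofBijective_apply, ofBijective_apply]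
    congr 1
    rcases x with p | p | p | j
    · cases ht : ty p <;> simp [f, rot_mn, ht, h3]
    · cases ht : ty p <;> simp [f, rot_md, ht]
    · cases ht : ty p <;> simp [f, rot_ls, ht, h3]
    · have := π.supportᶜ.orderEmbOfFin_mem hcard' j
      exact Perm.notMem_support.1 (Finset.mem_compl.1 this)

theorem card_support_permCongr (hn : n = r + 3 * m) (e : Pt m r ≃ Fin n) (ty : Fin m → Bool) :
    (e.permCongr (rot ty)).support.card = 3 * m := by
  have : (e.permCongr (rot ty)).supportᶜ =
      Finset.univ.map
        ((⟨fx, fun _ _ h => by injection h⟩ : Fin r ↪ Pt m r).trans e.toEmbedding) := by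
    ext x
    obtain ⟨x, rfl⟩ := e.surjective x
    rw [Finset.mem_compl, Perm.notMem_support, permCongr_apply, symm_apply_apply,
      EmbeddingLike.apply_eq_iff_eq, rot_eq_self_iff]
    simp only [Finset.mem_map, Finset.mem_univ, true_and, Function.Embedding.trans_apply]
    exact exists_congr fun j => eq_comm.trans e.injective.eq_iff.symm
  have h := congrArg Finset.card this
  rw [Finset.card_map, Finset.card_compl, Fintype.card_fin, Finset.card_univ, Fintype.card_fin] at h
  have := Finset.card_le_univ (e.permCongr (rot ty)).support
  simp only [Fintype.card_fin] at this
  omega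

theorem permCongr_rot_three (e : Pt m r ≃ Fin n) (ty : Fin m → Bool) (x : Fin n) :
    e.permCongr (rot ty) (e.permCongr (rot ty) (e.permCongr (rot ty) x)) = x := by
  simp [rot_rot_rot]

end Pt

/-! ### 132-avoidance as conditions on the order of the points -/

namespace Pt

variable {n m r : ℕ}

theorem avoids132_permCongr (e : Pt m r ≃ Fin n) (σ : Perm (Pt m r)) :
    Avoids132 (e.permCongr σ) ↔ ∀ x y z, e x < e y → e y < e z → e (σ x) < e (σ z) →
      ¬ e (σ z) < e (σ y) := by
  constructor
  · intro h x y z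
    simpa using h (e x) (e y) (e z)
  · intro h x y z
    obtain ⟨x, rfl⟩ := e.surjective x
    obtain ⟨y, rfl⟩ := e.surjective y
    obtain ⟨z, rfl⟩ := e.surjective z
    simpa using h x y z

/-- The conditions on the order of the points that make `e.permCongr (rot ty)` avoid `132`. -/
structure IsGood (e : Pt m r ≃ Fin n) (ty : Fin m → Bool) : Prop where
  mn_lt_md : ∀ p q, e (mn p) < e (md q)
  mn_lt_fx : ∀ p j, e (mn p) < e (fx j)
  ls_lt_ls : ∀ p q, p < q → e (ls p) < e (ls q)
  cut_md : ∀ p q k, e (md p) < e (ls q) → e (ls q) < e (md k) → e (mn k) < e (mn p)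
  cut_ls : ∀ p q k, e (ls p) < e (md q) → e (md q) < e (ls k) → e (mn k) < e (mn p)
  avoids_mn : Avoids132 fun p => e (mn p)
  ls_lt_fx : ∀ p j, e (md p) < e (fx j) → e (ls p) < e (fx j)
  ls_lt_md : ∀ p q, p < q → ty p ≠ ty q → e (ls p) < e (md q)

section forward

variable {e : Pt m r ≃ Fin n} {ty : Fin m → Bool}

theorem IsArranged.isGood (he : IsArranged e) (hav : Avoids132 (e.permCongr (rot ty))) :
    IsGood e ty := by
  rw [avoids132_permCongr] at hav
  have a1 := he.mn_lt_md
  have a2 := he.md_lt_ls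
  have a3 : ∀ p q, p < q → e (md p) < e (md q) := fun p q h => he.md_mono h
  -- Otherwise `x` starts a 132 pattern together with two points of the cycle `p` whose images, in
  -- order, are its greatest and its least point.
  have f1 : ∀ p x, e x < e (mn p) → ¬ e (rot ty x) < e (mn p) := by
    intro p x hx hx'
    have := a1 p
    have := a2 p
    cases hp : ty p
    · have := hav x (md p) (ls p)
      simp only [rot_md, rot_ls, hp, Bool.false_eq_true, if_false] at this
      omega
    · have := hav x (mn p) (md p)
      simp only [rot_md, rot_mn, hp, if_true] at this
      omega
  -- If `md q` came first, `mn q` and `md q` would both lie below `mn p`, and one of them is the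
  -- image of the other, against `f1`.
  have f2 : ∀ p q, e (mn p) < e (md q) := by
    intro p q
    by_contra h
    have h1 : e (md q) < e (mn p) := by
      have : e (md q) ≠ e (mn p) := by simp
      omega
    have := a1 q
    cases hq : ty q
    · have := f1 p (mn q)
      simp only [rot_mn, hq, Bool.false_eq_true, if_false] at this
      omega
    · have := f1 p (md q)
      simp only [rot_md, hq, if_true] at this
      omega
  have f3 : ∀ p j, e (mn p) < e (fx j) := by
    intro p j
    have h : e (mn p) ≠ e (fx j) := by simp
    have := f1 p (fx j)
    simp only [rot_fx] at this
    omega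
  have f4 : ∀ p q, p < q → e (ls p) < e (ls q) := by
    intro p q hpq
    by_contra h
    have h1 : e (ls q) ≠ e (ls p) := by simp [hpq.ne']
    have := a1 p
    have := a2 p
    have := a2 q
    have := a3 p q hpq
    have := f2 p q
    cases hp : ty p <;> cases hq : ty q
    · have := hav (mn p) (md p) (md q)
      simp only [rot_md, rot_mn, hp, hq, Bool.false_eq_true, if_false] at this
      omega
    · have := hav (mn p) (md p) (ls q)
      simp only [rot_md, rot_mn, rot_ls, hp, hq, Bool.false_eq_true, if_false, if_true] at this
      omega
    · have := hav (md p) (md q) (ls p)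
      simp only [rot_md, rot_ls, hp, hq, Bool.false_eq_true, if_false, if_true] at this
      omega
    · have := hav (md p) (ls q) (ls p)
      simp only [rot_md, rot_ls, hp, hq, if_true] at this
      omega
  have f5 : ∀ p q, p < q → ty p ≠ ty q → e (ls p) < e (md q) := by
    intro p q hpq hne
    by_contra h
    have h1 : e (md q) ≠ e (ls p) := by simp
    have := a1 p
    have := a2 p
    have := a2 q
    have := a3 p q hpq
    have := f2 p q
    have := f4 p q hpq
    cases hp : ty p <;> cases hq : ty q
    · exact hne (hp.trans hq.symm)
    · have := hav (mn p) (md p) (ls q)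
      simp only [rot_md, rot_mn, rot_ls, hp, hq, Bool.false_eq_true, if_false, if_true] at this
      omega
    · have := hav (md p) (md q) (ls p)
      simp only [rot_md, rot_ls, hp, hq, Bool.false_eq_true, if_false, if_true] at this
      omega
    · exact hne (hp.trans hq.symm)
  have f6 : ∀ p q, p < q → ty p ≠ ty q → e (mn q) < e (mn p) := by
    intro p q hpq hne
    by_contra h
    have h1 : e (mn q) ≠ e (mn p) := by simp [hpq.ne']
    have := a1 p
    have := a2 p
    have := a2 q
    have := f2 q p
    have := f4 p q hpq
    cases hp : ty p <;> cases hq : ty q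
    · exact hne (hp.trans hq.symm)
    · have := hav (mn p) (mn q) (md p)
      simp only [rot_md, rot_mn, hp, hq, Bool.false_eq_true, if_false, if_true] at this
      omega
    · have := hav (md p) (ls p) (ls q)
      simp only [rot_md, rot_ls, hp, hq, Bool.false_eq_true, if_false, if_true] at this
      omega
    · exact hne (hp.trans hq.symm)
  -- By `f5` cycles of different directions do not interleave, so a cycle `q` of the other direction
  -- that meets the range between `p` and `k` separates them completely.
  have sep : ∀ p q k, p < k → ty p = ty k → ty q ≠ ty p → e (md p) < e (ls q) →
      e (md q) < e (ls k) → e (ls p) < e (md k) := by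
    intro p q k hpk h1 h2 h3 h4
    have := a2 q
    have hqp : q ≠ p := fun h => h2 (h ▸ rfl)
    have hqk : q ≠ k := fun h => h2 (h ▸ h1.symm)
    rcases lt_or_gt_of_ne hqp with h | h
    · have := f5 q p h h2
      omega
    · have := f5 p q h h2.symm
      rcases lt_or_gt_of_ne hqk with h' | h'
      · have := a3 q k h'
        omega
      · have := f5 k q h' (fun h => h2 (h.symm.trans h1.symm))
        omega
  have f7 : ∀ p q k, e (md p) < e (ls q) → e (ls q) < e (md k) → e (mn k) < e (mn p) := by
    intro p q k h1 h2
    have hpk : p < k := he.md_mono.lt_iff_lt.1 (h1.trans h2)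
    by_cases hne : ty p = ty k
    · by_contra h
      have h0 : e (mn k) ≠ e (mn p) := by simp [hpk.ne']
      have := a2 p
      have := a2 q
      have := a2 k
      have := f2 k p
      have := f2 k q
      have := f2 p k
      by_cases hq : ty q = ty p
      · cases hp : ty p
        · have := hav (mn p) (mn k) (md q)
          simp only [rot_md, rot_mn, ← hne, hq, hp, Bool.false_eq_true, if_false] at this
          omega
        · have := hav (md p) (ls q) (md k)
          simp only [rot_md, rot_ls, ← hne, hq, hp, if_true] at this
          omega
      · have := sep p q k hpk hne hq h1 (by omega)
        cases hp : ty p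
        · have := hav (mn p) (mn k) (md p)
          simp only [rot_md, rot_mn, ← hne, hp, Bool.false_eq_true, if_false] at this
          omega
        · have := hav (md p) (ls p) (md k)
          simp only [rot_md, rot_ls, ← hne, hp, if_true] at this
          omega
    · exact f6 p k hpk hne
  have f8 : ∀ p q k, e (ls p) < e (md q) → e (md q) < e (ls k) → e (mn k) < e (mn p) := by
    intro p q k h1 h2
    have hpk : p < k := by
      by_contra h
      rcases (not_lt.1 h).lt_or_eq with h | h
      · have := f4 k p h
        omega
      · subst h
        omega
    by_cases hne : ty p = ty k
    · by_contra h
      have h0 : e (mn k) ≠ e (mn p) := by simp [hpk.ne']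
      have := a2 p
      have := a2 q
      have := a2 k
      have := f2 k p
      have := f2 k q
      have := f2 p k
      have := f2 k k
      by_cases hq : ty q = ty p
      · cases hp : ty p
        · have := hav (ls p) (md q) (ls k)
          simp only [rot_md, rot_ls, ← hne, hq, hp, Bool.false_eq_true, if_false] at this
          omega
        · have := hav (mn p) (mn k) (ls q)
          simp only [rot_ls, rot_mn, ← hne, hq, hp, if_true] at this
          omega
      · have := sep p q k hpk hne hq (by omega) h2
        cases hp : ty p
        · have := hav (ls p) (md k) (ls k)
          simp only [rot_md, rot_ls, ← hne, hp, Bool.false_eq_true, if_false] at this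
          omega
        · have := hav (mn p) (mn k) (ls k)
          simp only [rot_ls, rot_mn, ← hne, hp, if_true] at this
          omega
    · exact f6 p k hpk hne
  refine ⟨f2, f3, f4, f7, f8, ?_, ?_, f5⟩
  · intro p q k hpq hqk h1 h2
    simp only at h1 h2
    -- By `f6` the least points descend when the direction changes, so all three cycles have the
    -- same direction. The images of their least points then increase with the index, so a 132
    -- pattern in the least points yields one at the positions `mn p`, `mn k`, `mn q`.
    have t1 : ty p = ty q := by
      by_contra h
      have := f6 p q hpq h
      omega
    have t2 : ty p = ty k := by
      by_contra h
      have := f6 p k (hpq.trans hqk) h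
      omega
    have := hav (mn p) (mn k) (mn q)
    have := a3 p q hpq
    have := a3 q k hqk
    have := f4 p q hpq
    have := f4 q k hqk
    cases hp : ty p <;>
      simp only [rot_mn, ← t1, ← t2, hp, Bool.false_eq_true, if_false, if_true] at * <;> omega
  · intro p j h
    by_contra h'
    have : e (ls p) ≠ e (fx j) := by simp
    have := a1 p
    cases hp : ty p
    · have := hav (mn p) (md p) (fx j)
      simp only [rot_md, rot_mn, hp, rot_fx, Bool.false_eq_true, if_false] at this
      omega
    · have := hav (md p) (fx j) (ls p)
      simp only [rot_md, rot_ls, rot_fx, hp, if_true] at this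
      omega

end forward

section backward

variable {e : Pt m r ≃ Fin n} {ty : Fin m → Bool}

/-- Only equality of directions enters `IsGood`, so the conditions pass to the inverse permutation.
-/
theorem IsGood.not_flip (hg : IsGood e ty) : IsGood e fun p => !ty p :=
  { hg with ls_lt_md := fun p q hpq h => hg.ls_lt_md p q hpq (by simpa using h) }

theorem IsArranged.mn_lt_mn_of_ne (he : IsArranged e) (hg : IsGood e ty) {p q : Fin m}
    (hpq : p < q) (hne : ty p ≠ ty q) : e (mn q) < e (mn p) :=
  hg.cut_md p p q (he.md_lt_ls p) (hg.ls_lt_md p q hpq hne)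

/-- Neither `x` nor its image is the least point of a cycle. -/
def IsUpper (ty : Fin m → Bool) : Pt m r → Prop
  | mn _ => False
  | md p => ty p = false
  | ls p => ty p = true
  | fx _ => True

/-- The permutation preserves the order of the points not involved with least points, so any 132
pattern must use a least point as argument or as value. -/
theorem IsArranged.rot_lt_rot (he : IsArranged e) (hg : IsGood e ty) {y z : Pt m r}
    (hy : IsUpper ty y) (hz : IsUpper ty z) (h : e y < e z) : e (rot ty y) < e (rot ty z) := by
  have a3 : ∀ p q, e (md p) < e (md q) ↔ p < q := fun p q => he.md_mono.lt_iff_lt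
  have a4 : StrictMono fun p => e (ls p) := fun p q h => hg.ls_lt_ls p q h
  have a5 : ∀ p q, e (ls p) < e (ls q) ↔ p < q := fun p q => a4.lt_iff_lt
  have a2 := he.md_lt_ls
  have a6 := hg.ls_lt_fx
  have a7 := hg.ls_lt_md
  rcases y with p | p | p | j <;> rcases z with q | q | q | k <;>
    simp only [IsUpper] at hy hz <;>
    simp only [rot_md, rot_ls, rot_fx, hy, hz, Bool.false_eq_true, if_false, if_true]
  · exact (a5 _ _).2 ((a3 _ _).1 h)
  · have hne : ty p ≠ ty q := by simp [hy, hz]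
    rcases lt_trichotomy p q with hpq | rfl | hpq
    · exact a7 p q hpq hne
    · exact absurd rfl hne
    · exact absurd (a7 q p hpq hne.symm) h.not_gt
  · exact a6 p k h
  · exact (a2 p).trans (h.trans (a2 q))
  · exact (a3 _ _).2 ((a5 _ _).1 h)
  · exact (a2 p).trans h
  · exact h.trans (a2 q)
  · have : e (md q) ≠ e (fx j) := by simp
    have := a6 q j
    omega
  · exact h

theorem IsArranged.mn_lt_of_isUpper (he : IsArranged e) (hg : IsGood e ty) {x : Pt m r}
    (hx : IsUpper ty x) (p : Fin m) : e (mn p) < e x := by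
  rcases x with q | q | q | j
  · exact hx.elim
  · exact hg.mn_lt_md p q
  · exact (hg.mn_lt_md p q).trans (he.md_lt_ls q)
  · exact hg.mn_lt_fx p j

theorem isUpper_rot {x : Pt m r} (hx : IsUpper ty x) : IsUpper (fun p => !ty p) (rot ty x) := by
  rcases x with q | q | q | j <;> simp only [IsUpper] at hx
  · simp [rot_md, hx, IsUpper]
  · simp [rot_ls, hx, IsUpper]
  · trivial

theorem mn_or_isUpper_or_rot (ty : Fin m → Bool) (x : Pt m r) :
    (∃ p, x = mn p) ∨ IsUpper ty x ∨ ∃ p, rot ty x = mn p := by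
  rcases x with p | p | p | j
  · exact Or.inl ⟨p, rfl⟩
  · cases h : ty p
    · exact Or.inr (Or.inl h)
    · exact Or.inr (Or.inr ⟨p, by simp [rot_md, h]⟩)
  · cases h : ty p
    · exact Or.inr (Or.inr ⟨p, by simp [rot_ls, h]⟩)
    · exact Or.inr (Or.inl h)
  · exact Or.inr (Or.inl trivial)

theorem IsArranged.mn_lt_rot_mn (he : IsArranged e) (hg : IsGood e ty) (p q : Fin m) :
    e (mn p) < e (rot ty (mn q)) := by
  have h1 := hg.mn_lt_md p q
  have h2 := he.md_lt_ls q
  cases h : ty q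
  · simpa [rot_mn, h] using h1
  · simpa [rot_mn, h] using h1.trans h2

theorem IsArranged.eq_and_lt_of_mn_lt_mn (he : IsArranged e) (hg : IsGood e ty) {p q : Fin m}
    (h : e (mn p) < e (mn q)) (h' : e (rot ty (mn p)) < e (rot ty (mn q))) :
    ty p = ty q ∧ p < q := by
  have a1 := he.md_lt_ls p
  have a2 := he.md_lt_ls q
  have hpq : p ≠ q := by rintro rfl; exact h.false
  by_cases hne : ty p = ty q
  · refine ⟨hne, hpq.lt_or_gt.resolve_right fun hqp => ?_⟩
    have b1 := he.md_mono hqp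
    have b2 := hg.ls_lt_ls q p hqp
    simp only at b1
    simp only [rot_mn, hne] at h'
    split at h' <;> omega
  · exfalso
    rcases hpq.lt_or_gt with hpq | hqp
    · exact (he.mn_lt_mn_of_ne hg hpq hne).not_gt h
    · have := hg.ls_lt_md q p hqp (Ne.symm hne)
      simp only [rot_mn] at h'
      split at h' <;> split at h' <;> omega

/-- The image of `x` exceeds all least points, hence so do the larger images of `y` and `z`, and
each of `y`, `z` is a least point or upper. Monotonicity on upper points leaves only the case where
`x` and `y` are both least points. -/
theorem IsArranged.no_pattern (he : IsArranged e) (hg : IsGood e ty) {x y z : Pt m r}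
    (hx : (∃ p, x = mn p) ∨ IsUpper ty x) (hxy : e x < e y) (hyz : e y < e z)
    (hxz : e (rot ty x) < e (rot ty z)) (hzy : e (rot ty z) < e (rot ty y)) : False := by
  have hrx : ∀ p, e (mn p) < e (rot ty x) := by
    intro p
    rcases hx with ⟨q, rfl⟩ | hx
    · exact he.mn_lt_rot_mn hg p q
    · exact he.mn_lt_of_isUpper hg.not_flip (isUpper_rot hx) p
  have hy : (∃ p, y = mn p) ∨ IsUpper ty y := by
    rcases mn_or_isUpper_or_rot ty y with h | h | ⟨p, h⟩
    · exact Or.inl h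
    · exact Or.inr h
    · have := hrx p
      rw [← h] at this
      omega
  have hz : (∃ p, z = mn p) ∨ IsUpper ty z := by
    rcases mn_or_isUpper_or_rot ty z with h | h | ⟨p, h⟩
    · exact Or.inl h
    · exact Or.inr h
    · have := hrx p
      rw [← h] at this
      omega
  rcases hy with ⟨q, rfl⟩ | hy
  · rcases hx with ⟨p, rfl⟩ | hx
    · obtain ⟨t1, hpq⟩ := he.eq_and_lt_of_mn_lt_mn hg hxy (hxz.trans hzy)
      have c1 := hg.cut_md p
      have c2 := hg.cut_ls p
      have a2 := he.md_lt_ls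
      rcases hz with ⟨k, rfl⟩ | hz
      · obtain ⟨t2, hpk⟩ := he.eq_and_lt_of_mn_lt_mn hg (hxy.trans hyz) hxz
        refine hg.avoids_mn p k q hpk ?_ hxy hyz
        by_contra hkq
        have hqk : q < k := lt_of_le_of_ne (not_lt.1 hkq) (by rintro rfl; exact hyz.false)
        have b1 := he.md_mono hqk
        have b2 := hg.ls_lt_ls q k hqk
        simp only at b1
        simp only [rot_mn, ← t1, ← t2] at hzy
        split at hzy <;> omega
      · have l1 := hg.ls_lt_md p
        have l2 := hg.ls_lt_ls p
        have p1 := a2 p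
        have p2 := a2 q
        rcases z with k | k | k | j
        · exact hz
        · have p3 := a2 k
          have b3 : ∀ k, k < p → e (ls k) < e (ls p) := fun k h => hg.ls_lt_ls k p h
          simp only [IsUpper] at hz
          simp only [rot_mn, rot_md, ← t1, hz, Bool.false_eq_true, if_false] at hxz hzy
          cases hp : ty p
          · simp only [hp, Bool.false_eq_true, if_false] at hxz hzy
            have := c1 k q hxz hzy
            omega
          · simp only [hp, if_true] at hxz hzy
            have hpk : p < k := by
              by_contra h
              rcases (not_lt.1 h).lt_or_eq with h | rfl
              · have := b3 k h
                omega
              · omega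
            have := c2 k q (l1 k hpk (by simp [hp, hz])) (by omega)
            omega
        · have p3 := a2 k
          simp only [IsUpper] at hz
          simp only [rot_mn, rot_ls, ← t1, hz, if_true] at hxz hzy
          cases hp : ty p
          · simp only [hp, Bool.false_eq_true, if_false] at hxz hzy
            have hpk : p < k := he.md_mono.lt_iff_lt.1 hxz
            have := l1 k hpk (by simp [hp, hz])
            have := c1 p q (by omega) (by omega)
            omega
          · simp only [hp, if_true] at hxz hzy
            have := c2 k q hxz hzy
            omega
        · simp only [rot_mn, rot_fx, ← t1] at hxz hzy
          have f1 := hg.ls_lt_fx p j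
          have f2 := hg.ls_lt_fx q j
          cases hp : ty p
          · simp only [hp, Bool.false_eq_true, if_false] at hxz hzy
            have := c1 p q (by omega) (by omega)
            omega
          · simp only [hp, if_true] at hxz hzy
            have : e (md q) ≠ e (fx j) := by simp
            have := c2 q q (by omega) (by omega)
            omega
    · exact (he.mn_lt_of_isUpper hg hx q).not_gt hxy
  · rcases hz with ⟨k, rfl⟩ | hz
    · exact (he.mn_lt_of_isUpper hg hy k).not_gt hyz
    · exact (he.rot_lt_rot hg hy hz hyz).not_gt hzy

theorem IsArranged.avoids132 (he : IsArranged e) (hg : IsGood e ty) :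
    Avoids132 (e.permCongr (rot ty)) := by
  rw [avoids132_permCongr]
  intro x y z hxy hyz hxz hzy
  rcases mn_or_isUpper_or_rot ty x with h | h | ⟨p, h⟩
  · exact he.no_pattern hg (Or.inl h) hxy hyz hxz hzy
  · exact he.no_pattern hg (Or.inr h) hxy hyz hxz hzy
  · have hs : ∀ x : Pt m r, rot (fun p => !ty p) (rot ty x) = x := fun x => by
      rw [← rot_symm, symm_apply_apply]
    refine he.no_pattern hg.not_flip (Or.inl ⟨p, h⟩) hxz hzy ?_ ?_ <;> simpa only [hs]

end backward

end Pt

/-! ### Orders determined by comparisons, and profiles of interleaved sequences -/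

theorem eq_of_lt_imp_lt {A : Type*} {n : ℕ} (e e' : A ≃ Fin n)
    (h : ∀ x y, e x < e y → e' x < e' y) : e = e' := by
  have hm : StrictMono (e.symm.trans e') := fun x y hxy => h _ _ (by simpa using hxy)
  have hid : ⇑(e.symm.trans e') = id :=
    (hm.range_inj strictMono_id).1 (by rw [Set.range_id, (e.symm.trans e').range_eq_univ])
  ext x
  have := congrFun hid (e x)
  simp only [trans_apply, symm_apply_apply, id] at this
  rw [this]

theorem exists_equiv_lt_iff {A L : Type*} [Fintype A] [LinearOrder L] {n : ℕ} (key : A → L)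
    (hkey : Function.Injective key) (hcard : Fintype.card A = n) :
    ∃ e : A ≃ Fin n, ∀ x y, e x < e y ↔ key x < key y := by
  let _ : LinearOrder A := LinearOrder.lift' key hkey
  exact ⟨(monoEquivOfFin A hcard).symm.toEquiv, fun x y =>
    (monoEquivOfFin A hcard).symm.lt_iff_lt⟩

/-- A discrete intermediate value theorem. -/
theorem exists_eq_of_step {f : ℕ → ℕ} (h0 : f 0 = 0) (h : ∀ t, f (t + 1) ≤ f t + 1) {M v : ℕ}
    (hv : v ≤ f M) : ∃ q ≤ M, f q = v := by
  induction M with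
  | zero => exact ⟨0, le_rfl, by omega⟩
  | succ M ih =>
    by_cases hM : v ≤ f M
    · obtain ⟨q, hq, h⟩ := ih hM
      exact ⟨q, by omega, h⟩
    · exact ⟨M + 1, le_rfl, by have := h M; omega⟩

/-- The numbers of runs of middle points and of greatest points completed before the `p`-th
such point, in a word in which the two kinds of runs alternate. -/
structure IsProfile (M : ℕ) (α β : ℕ → ℕ) : Prop where
  α_zero : α 0 = 0
  β_zero : β 0 = 0
  α_le_succ : ∀ t, α t ≤ α (t + 1)
  β_le_succ : ∀ t, β t ≤ β (t + 1)
  α_succ_le : ∀ t, α (t + 1) ≤ α t + 1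
  β_succ_le : ∀ t, β (t + 1) ≤ β t + 1
  α_le_β : ∀ t, α t ≤ β t
  α_eq_β : α M = β M

/-- The number of gaps before the point `p` at which a middle point comes after all the earlier
greatest points. -/
def level (α β : ℕ → ℕ) (p : ℕ) : ℕ :=
  ((Finset.range p).filter fun t => β t < α (t + 1)).card

@[simp] theorem level_zero (α β : ℕ → ℕ) : level α β 0 = 0 := by simp [level]

theorem level_succ (α β : ℕ → ℕ) (p : ℕ) :
    level α β (p + 1) = level α β p + if β p < α (p + 1) then 1 else 0 := by
  rw [level, Finset.range_add_one, Finset.filter_insert]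
  split
  · rw [Finset.card_insert_of_notMem (by simp), level]
  · rw [level, add_zero]

theorem level_succ_le (α β : ℕ → ℕ) (p : ℕ) : level α β (p + 1) ≤ level α β p + 1 := by
  rw [level_succ]
  split <;> omega

theorem level_mono (α β : ℕ → ℕ) : Monotone (level α β) :=
  monotone_nat_of_le_succ fun p => by rw [level_succ]; omega

theorem exists_level_eq (α β : ℕ → ℕ) {M v : ℕ} (hv : v ≤ level α β M) :
    ∃ p ≤ M, level α β p = v :=
  exists_eq_of_step (level_zero α β) (level_succ_le α β) hv

namespace IsProfile

variable {M : ℕ} {α β : ℕ → ℕ}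

theorem α_mono (h : IsProfile M α β) : Monotone α := monotone_nat_of_le_succ h.α_le_succ

theorem β_mono (h : IsProfile M α β) : Monotone β := monotone_nat_of_le_succ h.β_le_succ

/-- Some gap `t` with `p ≤ t < q` raises the level, and there `β p ≤ β t < α (t + 1) ≤ α q`. -/
theorem lt_of_level_lt (h : IsProfile M α β) {p q : ℕ} (hpq : level α β p < level α β q) :
    β p < α q := by
  induction q with
  | zero => simp at hpq
  | succ q ih =>
    have h1 := h.α_le_succ q
    by_cases h2 : level α β p < level α β q
    · exact (ih h2).trans_le h1
    · rw [level_succ] at hpq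
      have h3 : β q < α (q + 1) := by
        by_contra hlt
        rw [if_neg hlt] at hpq
        omega
      have hle : p ≤ q := by
        by_contra hlt
        have := level_mono α β (show q + 1 ≤ p by omega)
        rw [level_succ] at this
        omega
      exact (h.β_mono hle).trans_lt h3

theorem exists_α_eq (h : IsProfile M α β) {v : ℕ} (hv : v ≤ α M) : ∃ p ≤ M, α p = v :=
  exists_eq_of_step h.α_zero h.α_succ_le hv

theorem exists_β_eq (h : IsProfile M α β) {v : ℕ} (hv : v ≤ β M) : ∃ p ≤ M, β p = v :=
  exists_eq_of_step h.β_zero h.β_succ_le hv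

/-- Both sequences take every value up to their common final value, so two consecutive runs of
middle points are separated by a greatest point. -/
theorem exists_of_α_lt (h : IsProfile M α β) {p : ℕ} (hp : p < M) (hlt : α p < α (p + 1)) :
    ∃ q ≤ M, α p ≤ β q ∧ β q < α (p + 1) := by
  obtain ⟨q, hq, hβ⟩ := h.exists_β_eq (v := α p) (by
    rw [← h.α_eq_β]
    exact h.α_mono hp.le)
  exact ⟨q, hq, by omega, by omega⟩

theorem exists_of_β_lt (h : IsProfile M α β) {q : ℕ} (hq : q < M) (hlt : β q < β (q + 1)) :
    ∃ p ≤ M, β q < α p ∧ α p ≤ β (q + 1) := by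
  obtain ⟨p, hp, hα⟩ := h.exists_α_eq (v := β (q + 1)) (by
    rw [h.α_eq_β]
    exact h.β_mono hq)
  exact ⟨p, hp, by omega, by omega⟩

/-- A rise of either sequence is witnessed by a value of the other lying in between, so the
comparisons determine all the unit steps and hence both sequences. -/
theorem eq_of_le_iff_le (h : IsProfile M α β) {α' β' : ℕ → ℕ} (h' : IsProfile M α' β')
    (hR : ∀ p q, p ≤ M → q ≤ M → (α p ≤ β q ↔ α' p ≤ β' q)) :
    ∀ t ≤ M, α t = α' t ∧ β t = β' t := by
  have key : ∀ {α β α' β' : ℕ → ℕ}, IsProfile M α β → IsProfile M α' β' →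
      (∀ p q, p ≤ M → q ≤ M → (α p ≤ β q ↔ α' p ≤ β' q)) →
      ∀ t < M, (α t < α (t + 1) → α' t < α' (t + 1)) ∧ (β t < β (t + 1) → β' t < β' (t + 1)) := by
    intro α β α' β' h h' hR t ht
    constructor
    · intro hlt
      obtain ⟨q, hq, h1, h2⟩ := h.exists_of_α_lt ht hlt
      have h3 := (hR t q ht.le hq).1 h1
      have h4 := mt (hR (t + 1) q ht hq).2 h2.not_ge
      omega
    · intro hlt
      obtain ⟨p, hp, h1, h2⟩ := h.exists_of_β_lt ht hlt
      have h3 := (hR p (t + 1) hp ht).1 h2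
      have h4 := mt (hR p t hp ht.le).2 h1.not_ge
      omega
  intro t ht
  induction t with
  | zero => rw [h.α_zero, h.β_zero, h'.α_zero, h'.β_zero]; exact ⟨rfl, rfl⟩
  | succ t ih =>
    have k1 := key h h' hR t ht
    have k2 := key h' h (fun p q hp hq => (hR p q hp hq).symm) t ht
    have := ih (by omega)
    have := h.α_le_succ t
    have := h.β_le_succ t
    have := h.α_succ_le t
    have := h.β_succ_le t
    have := h'.α_le_succ t
    have := h'.β_le_succ t
    have := h'.α_succ_le t
    have := h'.β_succ_le t
    omega

end IsProfile

theorem exists_isProfile (M : ℕ) {d l : ℕ → ℕ} (hd : StrictMono d) (hl : StrictMono l)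
    (hdl : ∀ p, d p < l p) (hne : ∀ p q, d p ≠ l q) :
    ∃ α β, IsProfile M α β ∧ ∀ p q, p ≤ M → q ≤ M → (α p ≤ β q ↔ d p < l q) := by
  classical
  -- The gaps at which a run of middle points ends. Both counts are taken over these gaps: `α`
  -- counts the next runs begun by the time of `d p`, and `β` those begun before `l q`.
  let B : Finset ℕ := (Finset.range M).filter fun i => ∃ q, d i < l q ∧ l q < d (i + 1)
  let α : ℕ → ℕ := fun p => (B.filter fun i => d (i + 1) ≤ d p).card
  let β : ℕ → ℕ := fun q => (B.filter fun i => d (i + 1) < l q).card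
  have hB : ∀ i, i ∈ B ↔ i < M ∧ ∃ q, d i < l q ∧ l q < d (i + 1) := by simp [B]
  have hle : ∀ p q, d p < l q → α p ≤ β q := fun p q h =>
    Finset.card_le_card (Finset.monotone_filter_right _ fun i _ hi => lt_of_le_of_lt hi h)
  have hlt : ∀ p q, p ≤ M → l q < d p → β q < α p := by
    intro p q hp h
    have hex : ∃ k, l q < d k := ⟨p, h⟩
    have hk := Nat.find_spec hex
    have hmin := fun k => Nat.find_min hex (m := k)
    have hkp := Nat.find_min' hex h
    -- `k` is the first index with `d k` beyond `l q`; the gap before it lies in `B` and is counted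
    -- by `α p` but not by `β q`.
    generalize Nat.find hex = k at hk hmin hkp
    have hk0 : k ≠ 0 := by
      rintro rfl
      have := hdl 0
      have := hl.monotone (Nat.zero_le q)
      omega
    obtain ⟨k, rfl⟩ := Nat.exists_eq_succ_of_ne_zero hk0
    have h1 := hmin k (by omega)
    have h2 := hne k q
    refine Finset.card_lt_card (Finset.ssubset_iff_of_subset ?_ |>.2 ⟨k, ?_, ?_⟩)
    · exact Finset.monotone_filter_right _ fun i _ hi => (lt_trans hi h).le
    · exact Finset.mem_filter.2 ⟨(hB k).2 ⟨by omega, q, by omega, hk⟩, hd.monotone hkp⟩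
    · intro hmem
      exact (Finset.mem_filter.1 hmem).2.not_gt hk
  refine ⟨α, β, ⟨?_, ?_, ?_, ?_, ?_, ?_, fun t => hle t t (hdl t), ?_⟩, fun p q hp _ => ⟨fun h => ?_,
    hle p q⟩⟩
  · refine Finset.card_eq_zero.2 (Finset.filter_eq_empty_iff.2 fun i _ h => ?_)
    have := hd.le_iff_le.1 h
    omega
  · refine Finset.card_eq_zero.2 (Finset.filter_eq_empty_iff.2 fun i hi h => ?_)
    obtain ⟨-, q, -, hq⟩ := (hB i).1 hi
    have := hl.monotone (Nat.zero_le q)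
    omega
  · exact fun t => Finset.card_le_card (Finset.monotone_filter_right _ fun i _ hi =>
      le_trans hi (hd.monotone (Nat.le_succ t)))
  · exact fun t => Finset.card_le_card (Finset.monotone_filter_right _ fun i _ hi =>
      lt_of_lt_of_le hi (hl.monotone (Nat.le_succ t)))
  · intro t
    refine (Finset.card_le_card (t := insert t (B.filter fun i => d (i + 1) ≤ d t)) ?_).trans
      (Finset.card_insert_le _ _)
    intro i hi
    obtain ⟨h1, h2⟩ := Finset.mem_filter.1 hi
    have := hd.le_iff_le.1 h2
    rcases Nat.lt_or_ge i t with h | h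
    · exact Finset.mem_insert_of_mem (Finset.mem_filter.2 ⟨h1, hd.monotone h⟩)
    · exact Finset.mem_insert.2 (Or.inl (by omega))
  · intro t
    have hsub : (B.filter fun i => d (i + 1) < l t) ⊆ B.filter fun i => d (i + 1) < l (t + 1) :=
      Finset.monotone_filter_right _ fun i _ hi => lt_of_lt_of_le hi (hl.monotone (Nat.le_succ t))
    have hone : ((B.filter fun i => d (i + 1) < l (t + 1)) \
        B.filter fun i => d (i + 1) < l t).card ≤ 1 := by
      have aux : ∀ i j, i ∈ B → j ∈ B → d (j + 1) < l (t + 1) → ¬ d (i + 1) < l t → ¬ i < j := by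
        intro i j _ hj h1 h2 hij
        obtain ⟨-, q, hq1, hq2⟩ := (hB j).1 hj
        have := hd.monotone (show i + 1 ≤ j by omega)
        have := hl.lt_iff_lt.1 (show l t < l q by omega)
        have := hl.lt_iff_lt.1 (show l q < l (t + 1) by omega)
        omega
      refine Finset.card_le_one.2 fun i hi j hj => ?_
      simp only [Finset.mem_sdiff, Finset.mem_filter, not_and] at hi hj
      have := aux i j hi.1.1 hj.1.1 hj.1.2 (hi.2 hi.1.1)
      have := aux j i hj.1.1 hi.1.1 hi.1.2 (hj.2 hj.1.1)
      omega
    have := Finset.card_sdiff_add_card_eq_card hsub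
    simp only [β]
    omega
  · refine congrArg Finset.card (Finset.filter_congr fun i hi => ?_)
    obtain ⟨hi, -⟩ := (hB i).1 hi
    have h1 := hd.monotone (show i + 1 ≤ M by omega)
    have := hdl M
    exact iff_of_true h1 (by omega)
  · by_contra hlt'
    have := hlt p q hp (by have := hne p q; omega)
    omega

/-! ### Orders of the points as combinatorial data -/

namespace Pt

variable {n M r : ℕ}

/-- The order of the points under `e` is given by the order `τ` of the least points, the profile
`α`, `β` of the middle and greatest points, and the levels `s` of the fixed points. -/
structure Realizes (e : Pt (M + 1) r ≃ Fin n) (τ : Perm (Fin (M + 1))) (α β : ℕ → ℕ)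
    (s : Fin r → ℕ) : Prop where
  mn_lt_mn : ∀ p q, e (mn p) < e (mn q) ↔ τ p < τ q
  mn_lt_md : ∀ p q, e (mn p) < e (md q)
  mn_lt_ls : ∀ p q, e (mn p) < e (ls q)
  mn_lt_fx : ∀ p j, e (mn p) < e (fx j)
  md_lt_md : ∀ p q, e (md p) < e (md q) ↔ p < q
  ls_lt_ls : ∀ p q, e (ls p) < e (ls q) ↔ p < q
  md_lt_ls : ∀ p q, e (md p) < e (ls q) ↔ α p ≤ β q
  fx_lt_md : ∀ j p, e (fx j) < e (md p) ↔ s j ≤ level α β p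
  fx_lt_ls : ∀ j p, e (fx j) < e (ls p) ↔ s j ≤ level α β p
  fx_lt_fx : ∀ i j, e (fx i) < e (fx j) ↔ i < j

variable {e e' : Pt (M + 1) r ≃ Fin n} {τ τ' : Perm (Fin (M + 1))} {α β α' β' : ℕ → ℕ}
  {s s' : Fin r → ℕ}

theorem lt_iff_lt_of_ne {x y : Pt (M + 1) r} (hxy : x ≠ y) (h : e x < e y ↔ e' x < e' y) :
    e y < e x ↔ e' y < e' x := by
  have h1 : e x ≠ e y := e.injective.ne hxy
  have h2 : e' x ≠ e' y := e'.injective.ne hxy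
  omega

theorem Realizes.eq (h : Realizes e τ α β s) (h' : Realizes e' τ α β s) : e = e' := by
  refine eq_of_lt_imp_lt e e' fun x y => Iff.mp ?_
  have a : ∀ p q, e (mn p) < e (md q) ↔ e' (mn p) < e' (md q) := fun p q =>
    iff_of_true (h.mn_lt_md p q) (h'.mn_lt_md p q)
  have b : ∀ p q, e (mn p) < e (ls q) ↔ e' (mn p) < e' (ls q) := fun p q =>
    iff_of_true (h.mn_lt_ls p q) (h'.mn_lt_ls p q)
  have c : ∀ p q, e (mn p) < e (fx q) ↔ e' (mn p) < e' (fx q) := fun p q =>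
    iff_of_true (h.mn_lt_fx p q) (h'.mn_lt_fx p q)
  have d : ∀ p q, e (md p) < e (ls q) ↔ e' (md p) < e' (ls q) := fun p q =>
    (h.md_lt_ls p q).trans (h'.md_lt_ls p q).symm
  have f : ∀ p q, e (fx p) < e (md q) ↔ e' (fx p) < e' (md q) := fun p q =>
    (h.fx_lt_md p q).trans (h'.fx_lt_md p q).symm
  have g : ∀ p q, e (fx p) < e (ls q) ↔ e' (fx p) < e' (ls q) := fun p q =>
    (h.fx_lt_ls p q).trans (h'.fx_lt_ls p q).symm
  rcases x with p | p | p | p <;> rcases y with q | q | q | q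
  · exact (h.mn_lt_mn p q).trans (h'.mn_lt_mn p q).symm
  · exact a p q
  · exact b p q
  · exact c p q
  · exact lt_iff_lt_of_ne (by simp) (a q p)
  · exact (h.md_lt_md p q).trans (h'.md_lt_md p q).symm
  · exact d p q
  · exact lt_iff_lt_of_ne (by simp) (f q p)
  · exact lt_iff_lt_of_ne (by simp) (b q p)
  · exact lt_iff_lt_of_ne (by simp) (d q p)
  · exact (h.ls_lt_ls p q).trans (h'.ls_lt_ls p q).symm
  · exact lt_iff_lt_of_ne (by simp) (g q p)
  · exact lt_iff_lt_of_ne (by simp) (c q p)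
  · exact f p q
  · exact g p q
  · exact (h.fx_lt_fx p q).trans (h'.fx_lt_fx p q).symm

/-- A key whose lexicographic order is the order prescribed by `Realizes`. -/
def key (τ : Perm (Fin (M + 1))) (α β : ℕ → ℕ) (s : Fin r → ℕ) : Pt (M + 1) r → ℕ ×ₗ (ℕ ×ₗ ℕ)
  | mn p => toLex (0, toLex (0, τ p))
  | md p => toLex (2 * level α β p + 2, toLex (2 * α p, p))
  | ls p => toLex (2 * level α β p + 2, toLex (2 * β p + 1, p))
  | fx j => toLex (2 * s j + 1, toLex (0, j))

theorem key_injective : Function.Injective (key τ α β s) := by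
  intro x y h
  rcases x with p | p | p | p <;> rcases y with q | q | q | q <;>
    simp only [key, EmbeddingLike.apply_eq_iff_eq, Prod.mk.injEq] at h
  any_goals omega
  · rw [τ.injective (Fin.ext h.2.2)]
  · rw [Fin.ext h.2.2]
  · rw [Fin.ext h.2.2]
  · rw [Fin.ext h.2.2]

/-- Order the points by `key`. Its first entry is 0 for least points, even for the components and
odd for the slots of fixed points around them; inside a component, `2 * α` and `2 * β + 1` make the
runs alternate. Comparisons across components agree with the profile by `IsProfile.lt_of_level_lt`.
-/
theorem exists_realizes (hn : n = r + 3 * (M + 1)) (hP : IsProfile M α β)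
    (τ : Perm (Fin (M + 1))) (hs : Monotone s) :
    ∃ e : Pt (M + 1) r ≃ Fin n, Realizes e τ α β s := by
  obtain ⟨e, he⟩ := exists_equiv_lt_iff (key τ α β s) key_injective (card_pt.trans hn.symm)
  have lm := level_mono α β
  have am := hP.α_mono
  have bm := hP.β_mono
  refine ⟨e, ?_, ?_, ?_, ?_, ?_, ?_, ?_, ?_, ?_, ?_⟩ <;> intro p q <;> rw [he] <;>
    simp only [key, Prod.Lex.toLex_lt_toLex]
  · simp
  · omega
  · omega
  · omega
  · constructor
    · intro h
      by_contra hlt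
      have := lm (show (q : ℕ) ≤ p by omega)
      have := am (show (q : ℕ) ≤ p by omega)
      omega
    · intro h
      have := lm (show (p : ℕ) ≤ q by omega)
      have := am (show (p : ℕ) ≤ q by omega)
      omega
  · constructor
    · intro h
      by_contra hlt
      have := lm (show (q : ℕ) ≤ p by omega)
      have := bm (show (q : ℕ) ≤ p by omega)
      omega
    · intro h
      have := lm (show (p : ℕ) ≤ q by omega)
      have := bm (show (p : ℕ) ≤ q by omega)
      omega
  · rcases lt_trichotomy (level α β p) (level α β q) with h | h | h
    · have := hP.lt_of_level_lt h
      have := hP.α_le_β p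
      have := hP.α_le_β q
      omega
    · omega
    · have := hP.lt_of_level_lt h
      omega
  · omega
  · omega
  · constructor
    · intro h
      by_contra hlt
      have := hs (show q ≤ p by omega)
      simp only [true_and, lt_irrefl, false_or] at h
      omega
    · intro h
      have := hs h.le
      simp only [true_and, lt_irrefl, false_or]
      omega

theorem Realizes.isArranged (h : Realizes e τ α β s) (hP : IsProfile M α β) : IsArranged e where
  mn_lt_md p := h.mn_lt_md p p
  md_lt_ls p := (h.md_lt_ls p p).2 (hP.α_le_β p)
  md_mono p q hpq := (h.md_lt_md p q).2 hpq
  fx_mono p q hpq := (h.fx_lt_fx p q).2 hpq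

/-- The gaps at which the profile forces the least points to be cut. -/
def CutAtBreaks (M : ℕ) (τ : Perm (Fin (M + 1))) (α β : ℕ → ℕ) : Prop :=
  ∀ t < M, α t < α (t + 1) ∨ β t < β (t + 1) → Cut τ (t + 1)

theorem exists_step_of_lt {f : ℕ → ℕ} {p k : ℕ} (hpk : p ≤ k) (h : f p < f k) :
    ∃ t, p ≤ t ∧ t < k ∧ f t < f (t + 1) := by
  induction k, hpk using Nat.le_induction with
  | base => omega
  | succ k hk ih =>
    by_cases h' : f p < f k
    · obtain ⟨t, h1, h2, h3⟩ := ih h'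
      exact ⟨t, h1, by omega, h3⟩
    · exact ⟨k, hk, by omega, by omega⟩

theorem Realizes.isGood (h : Realizes e τ α β s) (hP : IsProfile M α β)
    (hτ : Avoids132 τ) (hc : CutAtBreaks M τ α β) {ty : Fin (M + 1) → Bool}
    (hty : ∀ p q : Fin (M + 1), level α β p = level α β q → ty p = ty q) : IsGood e ty where
  mn_lt_md := h.mn_lt_md
  mn_lt_fx := h.mn_lt_fx
  ls_lt_ls p q := (h.ls_lt_ls p q).2
  cut_md p q k h1 h2 := by
    have h3 := (h.md_lt_ls p q).1 h1
    have h4 := mt (h.md_lt_ls k q).2 h2.not_gt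
    have hpk := (h.md_lt_md p k).1 (h1.trans h2)
    obtain ⟨t, ht1, ht2, ht3⟩ := exists_step_of_lt (f := α) (show (p : ℕ) ≤ k by omega) (by omega)
    exact (h.mn_lt_mn k p).2 (hc t (by omega) (Or.inl ht3) p k (by omega) (by omega))
  cut_ls p q k h1 h2 := by
    have h3 := (h.md_lt_ls q k).1 h2
    have h4 := mt (h.md_lt_ls q p).2 h1.not_gt
    have hpk := (h.ls_lt_ls p k).1 (h1.trans h2)
    obtain ⟨t, ht1, ht2, ht3⟩ := exists_step_of_lt (f := β) (show (p : ℕ) ≤ k by omega) (by omega)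
    exact (h.mn_lt_mn k p).2 (hc t (by omega) (Or.inr ht3) p k (by omega) (by omega))
  avoids_mn p q k hpq hqk h1 h2 :=
    hτ p q k hpq hqk ((h.mn_lt_mn _ _).1 h1) ((h.mn_lt_mn _ _).1 h2)
  ls_lt_fx p j h1 := by
    have h2 := mt (h.fx_lt_md j p).2 h1.not_gt
    have h3 := mt (h.fx_lt_ls j p).1 h2
    have : e (ls p) ≠ e (fx j) := by simp
    omega
  ls_lt_md p q hpq hne := by
    have h1 : level α β p < level α β q :=
      lt_of_le_of_ne (level_mono α β (Fin.le_def.1 hpq.le)) fun h => hne (hty p q h)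
    have h2 := mt (h.md_lt_ls q p).1 (hP.lt_of_level_lt h1).not_ge
    have : e (ls p) ≠ e (md q) := by simp
    omega

theorem Realizes.profile_eq (h : Realizes e τ α β s) (hP : IsProfile M α β)
    (h' : Realizes e τ' α' β' s') (hP' : IsProfile M α' β') :
    τ = τ' ∧ ∀ t ≤ M, α t = α' t ∧ β t = β' t := by
  refine ⟨eq_of_lt_imp_lt τ τ' fun x y hxy => (h'.mn_lt_mn x y).1 ((h.mn_lt_mn x y).2 hxy),
    hP.eq_of_le_iff_le hP' fun p q hp hq => ?_⟩
  rw [← h.md_lt_ls ⟨p, by omega⟩ ⟨q, by omega⟩, ← h'.md_lt_ls ⟨p, by omega⟩ ⟨q, by omega⟩]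

/-- Middle points realise every level from 0 to the last, so comparing with them detects `s j` in
that range; the bound leaves a single further value, the slot after all components. -/
theorem Realizes.level_fixed_eq (h : Realizes e τ α β s) (h' : Realizes e τ' α β s')
    (hs : ∀ j, s j ≤ level α β M + 1) (hs' : ∀ j, s' j ≤ level α β M + 1) : s = s' := by
  have key : ∀ {s s' : Fin r → ℕ}, (∀ (j : Fin r) (p : Fin (M + 1)),
      s j ≤ level α β p → s' j ≤ level α β p) → (∀ j, s' j ≤ level α β M + 1) → ∀ j, s' j ≤ s j := by
    intro s s' h hs' j
    by_contra hlt
    obtain ⟨p, hp, hps⟩ := exists_level_eq α β (M := M) (v := s j) (by have := hs' j; omega)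
    have := h j ⟨p, by omega⟩ hps.ge
    simp only [hps] at this
    omega
  funext j
  refine le_antisymm (key ?_ hs j) (key ?_ hs' j)
  · exact fun j p hj => (h.fx_lt_md j p).1 ((h'.fx_lt_md j p).2 hj)
  · exact fun j p hj => (h'.fx_lt_md j p).1 ((h.fx_lt_md j p).2 hj)

theorem IsArranged.exists_profile (he : IsArranged e) {ty : Fin (M + 1) → Bool}
    (hg : IsGood e ty) :
    ∃ α β, IsProfile M α β ∧ ∀ p q : Fin (M + 1), e (md p) < e (ls q) ↔ α p ≤ β q := by
  -- Beyond the actual cycles the values are continued above `n`, interleaved so that monotonicity,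
  -- `d p < l p` and disjointness persist.
  let d : ℕ → ℕ := fun p => if h : p < M + 1 then e (md ⟨p, h⟩) else n + 2 * p
  let l : ℕ → ℕ := fun p => if h : p < M + 1 then e (ls ⟨p, h⟩) else n + 2 * p + 1
  have hd : ∀ p (h : p < M + 1), d p = e (md ⟨p, h⟩) := fun p h => dif_pos h
  have hl : ∀ p (h : p < M + 1), l p = e (ls ⟨p, h⟩) := fun p h => dif_pos h
  have hd' : ∀ p, ¬ p < M + 1 → d p = n + 2 * p := fun p h => dif_neg h
  have hl' : ∀ p, ¬ p < M + 1 → l p = n + 2 * p + 1 := fun p h => dif_neg h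
  have hdm : StrictMono d := strictMono_nat_of_lt_succ fun p => by
    by_cases h : p + 1 < M + 1
    · rw [hd p (by omega), hd (p + 1) h]
      exact he.md_mono (Fin.lt_def.2 (Nat.lt_succ_self p))
    · rw [hd' _ h]
      by_cases h0 : p < M + 1
      · rw [hd p h0]
        omega
      · rw [hd' _ h0]
        omega
  have hlm : StrictMono l := strictMono_nat_of_lt_succ fun p => by
    by_cases h : p + 1 < M + 1
    · rw [hl p (by omega), hl (p + 1) h]
      exact hg.ls_lt_ls _ _ (Fin.lt_def.2 (Nat.lt_succ_self p))
    · rw [hl' _ h]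
      by_cases h0 : p < M + 1
      · rw [hl p h0]
        omega
      · rw [hl' _ h0]
        omega
  have hdl : ∀ p, d p < l p := fun p => by
    by_cases h : p < M + 1
    · rw [hd p h, hl p h]
      exact he.md_lt_ls _
    · rw [hd' p h, hl' p h]
      omega
  have hne : ∀ p q, d p ≠ l q := fun p q => by
    by_cases h : p < M + 1 <;> by_cases h' : q < M + 1
    · rw [hd p h, hl q h']
      exact fun hh => by simpa using e.injective (Fin.ext hh)
    · rw [hd p h, hl' q h']
      omega
    · rw [hd' p h, hl q h']
      omega
    · rw [hd' p h, hl' q h']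
      omega
  obtain ⟨α, β, hP, hR⟩ := exists_isProfile M hdm hlm hdl hne
  refine ⟨α, β, hP, fun p q => ?_⟩
  rw [hR p q (by omega) (by omega), hd p p.2, hl q q.2]
  rfl

section surjectivity

variable {ty : Fin (M + 1) → Bool}

theorem level_succ_of_ls_lt_md (hR : ∀ p q : Fin (M + 1), e (md p) < e (ls q) ↔ α p ≤ β q)
    {p : ℕ} (hp : p < M) (h : e (ls ⟨p, by omega⟩) < e (md ⟨p + 1, by omega⟩)) :
    level α β (p + 1) = level α β p + 1 := by
  have := mt (hR ⟨p + 1, by omega⟩ ⟨p, by omega⟩).2 h.not_gt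
  rw [level_succ, if_pos (by simpa using this)]

/-- Take 0 if no middle point precedes the fixed point, and otherwise one more than the level of the
last one that does. The greatest point of that cycle also precedes the fixed point, so the next
middle point, if any, starts a new level. -/
theorem IsArranged.exists_level (he : IsArranged e) (hg : IsGood e ty)
    (hR : ∀ p q : Fin (M + 1), e (md p) < e (ls q) ↔ α p ≤ β q) (j : Fin r) :
    ∃ s ≤ level α β M + 1, ∀ p : Fin (M + 1), e (fx j) < e (md p) ↔ s ≤ level α β p := by
  classical
  by_cases hex : ∃ p : Fin (M + 1), e (md p) < e (fx j)
  · obtain ⟨p, hp, hmax⟩ := (Finset.univ.filter fun p : Fin (M + 1) =>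
      e (md p) < e (fx j)).exists_max_image id (by simpa [Finset.Nonempty] using hex)
    simp only [Finset.mem_filter, Finset.mem_univ, true_and, id] at hp hmax
    refine ⟨level α β p + 1, ?_, fun q => ⟨fun h => ?_, fun h => ?_⟩⟩
    · have := level_mono α β (show (p : ℕ) ≤ M by omega)
      omega
    · have hpq : p < q := he.md_mono.lt_iff_lt.1 (hp.trans h)
      have hp1 : (p : ℕ) < M := by omega
      have h1 : ¬ e (md ⟨p + 1, by omega⟩) < e (fx j) := fun hlt => by
        have := Fin.le_def.1 (hmax _ hlt)
        simp at this
      have h2 := hg.ls_lt_fx p j hp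
      have := level_succ_of_ls_lt_md hR hp1 (h2.trans_le (not_lt.1 h1))
      have := level_mono α β (show (p : ℕ) + 1 ≤ q by omega)
      omega
    · have hpq : p < q := by
        by_contra hle
        have := level_mono α β (show (q : ℕ) ≤ p by omega)
        omega
      have h1 : ¬ e (md q) < e (fx j) := fun hlt => (hmax q hlt).not_gt hpq
      have : e (md q) ≠ e (fx j) := by simp
      omega
  · refine ⟨0, by omega, fun p => iff_of_true ?_ (Nat.zero_le _)⟩
    have h1 : ¬ e (md p) < e (fx j) := fun hlt => hex ⟨p, hlt⟩
    have : e (md p) ≠ e (fx j) := by simp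
    omega

/-- A change of direction between adjacent cycles puts the greatest point of the first before the
middle point of the second, which raises the level. -/
theorem IsGood.type_eq_of_level_eq (hg : IsGood e ty)
    (hR : ∀ p q : Fin (M + 1), e (md p) < e (ls q) ↔ α p ≤ β q) (p q : Fin (M + 1))
    (h : level α β p = level α β q) : ty p = ty q := by
  have key : ∀ (p k : ℕ) (hk : p + k < M + 1), level α β p = level α β (p + k) →
      ty ⟨p, by omega⟩ = ty ⟨p + k, hk⟩ := by
    intro p k hk hlev
    induction k with
    | zero => rfl
    | succ k ih =>
      have h1 := level_mono α β (show p ≤ p + k by omega)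
      have h2 := level_mono α β (show p + k ≤ p + (k + 1) by omega)
      refine (ih (by omega) (by omega)).trans ?_
      by_contra hne
      have h3 := hg.ls_lt_md ⟨p + k, by omega⟩ ⟨p + k + 1, by omega⟩
        (Fin.lt_def.2 (Nat.lt_succ_self _)) hne
      have := level_succ_of_ls_lt_md hR (by omega) h3
      rw [← Nat.add_assoc] at hlev
      omega
  rcases Nat.le_total p q with hpq | hpq
  · obtain ⟨k, hk⟩ := Nat.exists_eq_add_of_le hpq
    have := key p k (by omega) (by rw [← hk]; exact h)
    simpa only [← hk] using this
  · obtain ⟨k, hk⟩ := Nat.exists_eq_add_of_le hpq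
    have := key q k (by omega) (by rw [← hk]; exact h.symm)
    simpa only [← hk] using this.symm

theorem IsArranged.exists_data (he : IsArranged e) (hg : IsGood e ty) :
    ∃ τ α β s, IsProfile M α β ∧ Realizes e τ α β s ∧ Avoids132 τ ∧ CutAtBreaks M τ α β ∧
      (∀ p q : Fin (M + 1), level α β p = level α β q → ty p = ty q) ∧ Monotone s ∧
      ∀ j, s j ≤ level α β M + 1 := by
  obtain ⟨α, β, hP, hR⟩ := he.exists_profile hg
  obtain ⟨τ, hτ⟩ := exists_equiv_lt_iff (fun p => e (mn p))
    (fun p q h => by simpa using h) (Fintype.card_fin (M + 1))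
  choose s hs hs' using he.exists_level hg hR
  have hls : StrictMono fun p => e (ls p) := fun p q h => hg.ls_lt_ls p q h
  have hfl : ∀ j p, e (fx j) < e (ls p) ↔ s j ≤ level α β p := fun j p => by
    rw [← hs' j p]
    have h1 := hg.ls_lt_fx p j
    have h2 := he.md_lt_ls p
    have : e (md p) ≠ e (fx j) := by simp
    omega
  refine ⟨τ, α, β, s, hP, ⟨fun p q => (hτ p q).symm, hg.mn_lt_md,
    fun p q => (hg.mn_lt_md p q).trans (he.md_lt_ls q), hg.mn_lt_fx,
    fun p q => he.md_mono.lt_iff_lt, fun p q => hls.lt_iff_lt, hR, hs', hfl,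
    fun p q => he.fx_mono.lt_iff_lt⟩, ?_, ?_, hg.type_eq_of_level_eq hR, ?_, hs⟩
  · intro p q k hpq hqk h1 h2
    exact hg.avoids_mn p q k hpq hqk ((hτ _ _).1 h1) ((hτ _ _).1 h2)
  · intro t ht hbr p q hp hq
    rw [hτ]
    have hmd : ∀ p q : Fin (M + 1), p ≤ q → e (md p) ≤ e (md q) := fun p q h =>
      he.md_mono.monotone h
    have hlsm : ∀ p q : Fin (M + 1), p ≤ q → e (ls p) ≤ e (ls q) := fun p q h =>
      hls.monotone h
    -- A rise at `t` supplies a point of the other kind separating indices `t` and `t + 1`, hence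
    -- also `p` and `q`; the matching cut condition applies.
    rcases hbr with hbr | hbr
    · obtain ⟨k, hk, h1, h2⟩ := hP.exists_of_α_lt ht hbr
      have h3 := (hR ⟨t, by omega⟩ ⟨k, by omega⟩).2 h1
      have h4 := mt (hR ⟨t + 1, by omega⟩ ⟨k, by omega⟩).1 h2.not_ge
      have h5 := hmd p ⟨t, by omega⟩ (Fin.le_def.2 (by simp only; omega))
      have h6 := hmd ⟨t + 1, by omega⟩ q (Fin.le_def.2 (by simp only; omega))
      have h7 : e (ls ⟨k, by omega⟩) ≠ e (md ⟨t + 1, by omega⟩) := by simp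
      exact hg.cut_md p ⟨k, by omega⟩ q (by omega) (by omega)
    · obtain ⟨k, hk, h1, h2⟩ := hP.exists_of_β_lt ht hbr
      have h3 := (hR ⟨k, by omega⟩ ⟨t + 1, by omega⟩).2 h2
      have h4 := mt (hR ⟨k, by omega⟩ ⟨t, by omega⟩).1 h1.not_ge
      have h5 := hlsm p ⟨t, by omega⟩ (Fin.le_def.2 (by simp only; omega))
      have h6 := hlsm ⟨t + 1, by omega⟩ q (Fin.le_def.2 (by simp only; omega))
      have h7 : e (ls ⟨t, by omega⟩) ≠ e (md ⟨k, by omega⟩) := by simp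
      exact hg.cut_ls p ⟨k, by omega⟩ q (by omega) (by omega)
  · intro i j hij
    by_contra hlt
    obtain ⟨p, hp, hps⟩ := exists_level_eq α β (M := M) (v := s j) (by have := hs i; omega)
    have h1 := (hs' j ⟨p, by omega⟩).2 hps.ge
    have h2 := (hs' i ⟨p, by omega⟩).1 ((he.fx_mono.monotone hij).trans_lt h1)
    simp only [hps] at h2
    omega

end surjectivity

end Pt

/-! ### Profiles as Motzkin paths on gap words -/

open MotzkinStep

/-- The gap ends a run of middle points. -/
def endsMid : Option MotzkinStep → Bool
  | some down => true
  | some flat => true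
  | _ => false

/-- The gap ends a run of greatest points. -/
def endsLast : Option MotzkinStep → Bool
  | some up => true
  | some flat => true
  | _ => false

/-- The number of runs of middle points ended by the first `p` gaps. -/
def midRuns (g : List (Option MotzkinStep)) (p : ℕ) : ℕ := (g.take p).countP endsMid

/-- The number of runs of greatest points ended by the first `p` gaps. -/
def lastRuns (g : List (Option MotzkinStep)) (p : ℕ) : ℕ := (g.take p).countP endsLast

theorem countP_endsMid (g : List (Option MotzkinStep)) :
    g.countP endsMid = g.reduceOption.count down + g.reduceOption.count flat := by
  induction g with
  | nil => rfl
  | cons a g ih =>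
    rcases a with - | (- | - | -) <;> simp [List.countP_cons, endsMid, ih] <;> omega

theorem countP_endsLast (g : List (Option MotzkinStep)) :
    g.countP endsLast = g.reduceOption.count up + g.reduceOption.count flat := by
  induction g with
  | nil => rfl
  | cons a g ih =>
    rcases a with - | (- | - | -) <;> simp [List.countP_cons, endsLast, ih] <;> omega

theorem exists_take_reduceOption {α : Type*} (g : List (Option α)) (i : ℕ) :
    ∃ p, (g.take p).reduceOption = g.reduceOption.take i := by
  induction g generalizing i with
  | nil => exact ⟨0, by simp⟩
  | cons a g ih =>
    cases a with
    | none =>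
      obtain ⟨p, hp⟩ := ih i
      exact ⟨p + 1, by simpa using hp⟩
    | some a =>
      cases i with
      | zero => exact ⟨0, by simp⟩
      | succ i =>
        obtain ⟨p, hp⟩ := ih i
        exact ⟨p + 1, by simpa using hp⟩

theorem exists_reduceOption_take {α : Type*} (g : List (Option α)) (p : ℕ) :
    ∃ i, (g.take p).reduceOption = g.reduceOption.take i := by
  induction g generalizing p with
  | nil => exact ⟨0, by simp⟩
  | cons a g ih =>
    cases p with
    | zero => exact ⟨0, by simp⟩
    | succ p =>
      obtain ⟨i, hi⟩ := ih p
      cases a with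
      | none => exact ⟨i, by simpa using hi⟩
      | some a => exact ⟨i + 1, by simpa using hi⟩

theorem midRuns_succ (g : List (Option MotzkinStep)) (p : ℕ) :
    midRuns g (p + 1) = midRuns g p + g[p]?.toList.countP endsMid := by
  rw [midRuns, List.take_add_one, List.countP_append, midRuns]

theorem lastRuns_succ (g : List (Option MotzkinStep)) (p : ℕ) :
    lastRuns g (p + 1) = lastRuns g p + g[p]?.toList.countP endsLast := by
  rw [lastRuns, List.take_add_one, List.countP_append, lastRuns]

theorem isProfile_runs {g : List (Option MotzkinStep)}
    (hle : ∀ t ≤ g.length, midRuns g t ≤ lastRuns g t)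
    (heq : midRuns g g.length = lastRuns g g.length) :
    IsProfile g.length (midRuns g) (lastRuns g) := by
  have hone : ∀ (f : Option MotzkinStep → Bool) (p : ℕ), g[p]?.toList.countP f ≤ 1 :=
    fun f p => List.countP_le_length.trans (by cases g[p]? <;> simp)
  refine ⟨by simp [midRuns], by simp [lastRuns], fun t => ?_, fun t => ?_, fun t => ?_,
    fun t => ?_, fun t => ?_, heq⟩
  · rw [midRuns_succ]; omega
  · rw [lastRuns_succ]; omega
  · rw [midRuns_succ]; have := hone endsMid t; omega
  · rw [lastRuns_succ]; have := hone endsLast t; omega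
  · rcases Nat.le_total t g.length with h | h
    · exact hle t h
    · have := hle _ le_rfl
      rw [midRuns, lastRuns] at this ⊢
      rwa [List.take_of_length_le h, ← List.take_length (l := g)]

/-- Flats contribute equally to both run counts, so `α ≤ β` compares downs with ups. Prefixes of the
gap word and of its reduced word correspond. -/
theorem isMotzkinPath_reduceOption_iff (g : List (Option MotzkinStep)) :
    IsMotzkinPath g.reduceOption ↔ IsProfile g.length (midRuns g) (lastRuns g) := by
  constructor
  · rintro ⟨h1, h2⟩
    refine isProfile_runs (fun t _ => ?_) ?_
    · obtain ⟨i, hi⟩ := exists_reduceOption_take g t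
      rw [midRuns, lastRuns, countP_endsMid, countP_endsLast, hi]
      have := h2 i
      omega
    · rw [midRuns, lastRuns, countP_endsMid, countP_endsLast, List.take_length, h1]
  · intro h
    refine ⟨?_, fun i => ?_⟩
    · have := h.α_eq_β
      rw [midRuns, lastRuns, countP_endsMid, countP_endsLast, List.take_length] at this
      omega
    · obtain ⟨p, hp⟩ := exists_take_reduceOption g i
      have := h.α_le_β p
      rw [midRuns, lastRuns, countP_endsMid, countP_endsLast, hp] at this
      omega

theorem flatsAtLevelZero_append (w : List MotzkinStep) (a : MotzkinStep) :
    flatsAtLevelZero (w ++ [a]) =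
      flatsAtLevelZero w + if a = flat ∧ w.count up = w.count down then 1 else 0 := by
  rw [flatsAtLevelZero, List.length_append, List.length_singleton, Finset.range_add_one,
    Finset.filter_insert, flatsAtLevelZero]
  have hw : ((Finset.range w.length).filter fun i => (w ++ [a])[i]? = some flat ∧
      ((w ++ [a]).take i).count up = ((w ++ [a]).take i).count down) =
      (Finset.range w.length).filter fun i => w[i]? = some flat ∧
        (w.take i).count up = (w.take i).count down := by
    refine Finset.filter_congr fun i hi => ?_
    have hi := Finset.mem_range.1 hi
    rw [List.getElem?_append_left hi, List.take_append_of_le_length hi.le]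
  rw [hw]
  simp only [List.getElem?_concat_length, Option.some.injEq, List.take_left]
  split
  · rw [Finset.card_insert_of_notMem (by simp)]
  · rfl

/-- If `β t < α (t + 1)`, then `α t ≤ β t` and unit steps force `α t = β t` and a rise of `α`; then
`α (t + 1) ≤ β (t + 1)` makes `β` rise too. The gap is therefore a flat at level zero, and the
converse is immediate. -/
theorem level_runs {g : List (Option MotzkinStep)}
    (h : IsProfile g.length (midRuns g) (lastRuns g)) (p : ℕ) :
    level (midRuns g) (lastRuns g) p = flatsAtLevelZero (g.take p).reduceOption := by
  induction p with
  | zero => simp [flatsAtLevelZero]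
  | succ p ih =>
    have hle := h.α_le_β p
    have hle' := h.α_le_β (p + 1)
    rw [midRuns_succ, lastRuns_succ] at hle'
    rw [level_succ, ih, midRuns_succ, List.take_add_one]
    have e1 : midRuns g p = (g.take p).reduceOption.count down + (g.take p).reduceOption.count flat :=
      countP_endsMid _
    have e2 : lastRuns g p = (g.take p).reduceOption.count up + (g.take p).reduceOption.count flat :=
      countP_endsLast _
    revert hle'
    rcases g[p]? with - | - | a <;> intro hle'
    · simp
      omega
    · simp [List.reduceOption_append, endsMid]
      omega
    · rw [List.reduceOption_append, show (some (some a)).toList.reduceOption = [a] from rfl,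
        flatsAtLevelZero_append]
      congr 1
      cases a
      · simp [endsMid]
        omega
      · simp [endsMid, endsLast] at hle' ⊢
        omega
      · simp [endsMid, e1, e2]
        refine if_congr ?_ rfl rfl
        omega

theorem runs_lt_succ_iff (g : List (Option MotzkinStep)) (p : ℕ) :
    (midRuns g p < midRuns g (p + 1) ∨ lastRuns g p < lastRuns g (p + 1)) ↔
      ∃ a, g[p]? = some (some a) := by
  rw [midRuns_succ, lastRuns_succ]
  rcases g[p]? with - | - | - | - | - <;> simp [endsMid, endsLast]

theorem eq_of_runs_eq {M : ℕ} {g g' : List (Option MotzkinStep)} (hg : g.length = M)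
    (hg' : g'.length = M)
    (h : ∀ t ≤ M, midRuns g t = midRuns g' t ∧ lastRuns g t = lastRuns g' t) : g = g' := by
  refine List.ext_getElem (hg.trans hg'.symm) fun p hp hp' => ?_
  have h0 := h p (by omega)
  have h1 := h (p + 1) (by omega)
  rw [midRuns_succ, midRuns_succ, lastRuns_succ, lastRuns_succ, h0.1, h0.2,
    List.getElem?_eq_getElem hp, List.getElem?_eq_getElem hp'] at h1
  revert h1
  generalize g[p] = a
  generalize g'[p] = b
  rcases a with - | - | - | - <;> rcases b with - | - | - | - <;> simp [endsMid, endsLast]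

/-- The label of a gap that ends the given runs. -/
def gapLabel : Bool → Bool → Option MotzkinStep
  | false, false => none
  | true, false => some down
  | false, true => some up
  | true, true => some flat

theorem IsProfile.exists_runs_eq {M : ℕ} {α β : ℕ → ℕ} (h : IsProfile M α β) :
    ∃ g : List (Option MotzkinStep), g.length = M ∧
      ∀ t ≤ M, midRuns g t = α t ∧ lastRuns g t = β t := by
  refine ⟨(List.range M).map fun t => gapLabel (decide (α t < α (t + 1)))
    (decide (β t < β (t + 1))), by simp, fun t ht => ?_⟩
  induction t with
  | zero => simp [midRuns, lastRuns, h.α_zero, h.β_zero]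
  | succ t ih =>
    have ih := ih (by omega)
    have h1 := h.α_le_succ t
    have h2 := h.α_succ_le t
    have h3 := h.β_le_succ t
    have h4 := h.β_succ_le t
    rw [midRuns_succ, lastRuns_succ, ih.1, ih.2, List.getElem?_map, List.getElem?_range (by omega)]
    by_cases ha : α t < α (t + 1) <;> by_cases hb : β t < β (t + 1) <;>
      simp [ha, hb, gapLabel, endsMid, endsLast] <;> omega

theorem level_congr {M : ℕ} {α β α' β' : ℕ → ℕ} (h : ∀ t ≤ M, α t = α' t ∧ β t = β' t) {p : ℕ}
    (hp : p ≤ M) : level α β p = level α' β' p := by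
  refine congrArg Finset.card (Finset.filter_congr fun t ht => ?_)
  have := Finset.mem_range.1 ht
  rw [(h t (by omega)).2, (h (t + 1) (by omega)).1]

namespace Pt

variable {n M r : ℕ}

theorem Realizes.congr {e : Pt (M + 1) r ≃ Fin n} {τ : Perm (Fin (M + 1))} {α β α' β' : ℕ → ℕ}
    {s : Fin r → ℕ} (h : Realizes e τ α β s) (hab : ∀ t ≤ M, α t = α' t ∧ β t = β' t) :
    Realizes e τ α' β' s :=
  { h with
    md_lt_ls := fun p q => by
      rw [h.md_lt_ls, (hab p (by omega)).1, (hab q (by omega)).2]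
    fx_lt_md := fun j p => by rw [h.fx_lt_md, level_congr hab (by omega)]
    fx_lt_ls := fun j p => by rw [h.fx_lt_ls, level_congr hab (by omega)] }

end Pt

/-! ### The bijection with cycle data and the final count -/

instance : Fintype MotzkinStep := ⟨{up, down, flat}, by rintro (_ | _ | _) <;> simp⟩

theorem flatsAtLevelZero_le (w : List MotzkinStep) : flatsAtLevelZero w ≤ w.length :=
  (Finset.card_filter_le _ _).trans_eq (Finset.card_range _)

/-- The permutations counted by the main theorem. -/
def threeCyclePerms (n m : ℕ) : Set (Perm (Fin n)) :=
  {π | Avoids132 π ∧ (∀ x, π (π (π x)) = x) ∧ π.support.card = 3 * m}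

/-- Labelled gaps that form a Motzkin path. -/
abbrev GapWord (M : ℕ) : Type :=
  {g : List.Vector (Option MotzkinStep) M // IsMotzkinPath g.toList.reduceOption}

noncomputable instance (M : ℕ) : Fintype (GapWord M) := Fintype.ofFinite _

/-- The number of flats at level zero of the path of a gap word. -/
abbrev GapWord.flats {M : ℕ} (g : GapWord M) : ℕ := flatsAtLevelZero g.1.toList.reduceOption

/-- The data that determine a permutation in `threeCyclePerms`: the profile as a gap word, the order
of the least points, the directions of the cycles of each level, and the levels of the
fixed points. -/
abbrev CycleData (M r : ℕ) : Type :=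
  Σ g : GapWord M, cutPerms (M + 1) (blocks g.1.toList) ×
    (Fin (g.flats + 1) → Bool) × {s : Fin r → Fin (g.flats + 2) // Monotone s}

namespace GapWord

variable {M : ℕ} (g : GapWord M)

theorem isProfile : IsProfile M (midRuns g.1.toList) (lastRuns g.1.toList) := by
  have := (isMotzkinPath_reduceOption_iff _).1 g.2
  rwa [List.Vector.toList_length] at this

theorem level_eq_flats : level (midRuns g.1.toList) (lastRuns g.1.toList) M = g.flats := by
  rw [level_runs ((isMotzkinPath_reduceOption_iff _).1 g.2), List.take_of_length_le (by simp)]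

/-- The level of a cycle. -/
def lev (p : Fin (M + 1)) : Fin (g.flats + 1) :=
  ⟨level (midRuns g.1.toList) (lastRuns g.1.toList) p, by
    rw [← g.level_eq_flats]
    exact Nat.lt_succ_of_le (level_mono _ _ (by omega))⟩

theorem lev_surjective : Function.Surjective g.lev := by
  intro v
  obtain ⟨p, hp, h⟩ := exists_level_eq (midRuns g.1.toList) (lastRuns g.1.toList) (M := M) (v := v)
    (by rw [g.level_eq_flats]; omega)
  exact ⟨⟨p, by omega⟩, Fin.ext h⟩

theorem mem_cutPerms_iff (τ : Perm (Fin (M + 1))) : τ ∈ cutPerms (M + 1) (blocks g.1.toList) ↔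
    Avoids132 τ ∧ Pt.CutAtBreaks M τ (midRuns g.1.toList) (lastRuns g.1.toList) := by
  rw [cutPerms_blocks _ _ (by simp)]
  refine and_congr_right fun _ => ⟨fun h t _ hbr => ?_, fun h p a hp => ?_⟩
  · obtain ⟨a, ha⟩ := (runs_lt_succ_iff _ _).1 hbr
    exact h t a ha
  · obtain ⟨hlt, -⟩ := List.getElem?_eq_some_iff.1 hp
    exact h p (by simpa using hlt) ((runs_lt_succ_iff _ _).2 ⟨a, hp⟩)

end GapWord

open Pt

/-- Each datum has a unique realising order, and rotating its cycles gives a permutation. The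
permutation returns the order and directions, and the order returns the gap word, the order of least
points and the slots of fixed points. -/
theorem ncard_threeCyclePerms {n M r : ℕ} (hn : n = r + 3 * (M + 1)) :
    (threeCyclePerms n (M + 1)).ncard = Nat.card (CycleData M r) := by
  have hex : ∀ d : CycleData M r, ∃ e : Pt (M + 1) r ≃ Fin n,
      Realizes e d.2.1 (midRuns d.1.1.toList) (lastRuns d.1.1.toList) fun j => d.2.2.2.1 j :=
    fun d => exists_realizes hn d.1.isProfile _ fun i j hij => d.2.2.2.2 hij
  choose e he using hex
  let F : CycleData M r → Perm (Fin n) := fun d => (e d).permCongr (rot (d.2.2.1 ∘ d.1.lev))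
  have hinj : Function.Injective F := by
    intro d d' h
    obtain ⟨hee, hty⟩ := ((he d).isArranged d.1.isProfile).eq_of_permCongr_eq
      ((he d').isArranged d'.1.isProfile) h
    have h1 := he d
    have h2 := he d'
    rw [← hee] at h2
    obtain ⟨hτ, hab⟩ := h1.profile_eq d.1.isProfile h2 d'.1.isProfile
    obtain ⟨g, τ, t, s⟩ := d
    obtain ⟨g', τ', t', s'⟩ := d'
    have hg : g = g' := Subtype.ext (Subtype.ext (eq_of_runs_eq (by simp) (by simp) hab))
    subst hg
    obtain rfl : τ = τ' := Subtype.ext hτ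
    obtain rfl : t = t' := g.lev_surjective.injective_comp_right hty
    have hs := h1.level_fixed_eq h2 (fun j => by rw [g.level_eq_flats]; simp only; omega)
      (fun j => by rw [g.level_eq_flats]; simp only; omega)
    obtain rfl : s = s' := Subtype.ext (funext fun j => Fin.ext (congrFun hs j))
    rfl
  have hrange : Set.range F = threeCyclePerms n (M + 1) := by
    apply Set.Subset.antisymm
    · rintro _ ⟨d, rfl⟩
      have hmem := (d.1.mem_cutPerms_iff _).1 d.2.1.2
      have harr := (he d).isArranged d.1.isProfile
      refine ⟨harr.avoids132 ((he d).isGood d.1.isProfile hmem.1 hmem.2 ?_), permCongr_rot_three _ _,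
        card_support_permCongr hn _ _⟩
      exact fun p q hpq => congrArg d.2.2.1 (Fin.ext hpq)
    · rintro π ⟨hav, h3, hs⟩
      obtain ⟨e', ty, harr, rfl⟩ := exists_isArranged hn h3 hs
      have hgood := harr.isGood hav
      obtain ⟨τ, α, β, s, hP, hR, hτ, hcut, hty, hmono, hle⟩ := harr.exists_data hgood
      obtain ⟨l, hl, hlr⟩ := hP.exists_runs_eq
      subst hl
      have hab : ∀ t ≤ l.length, α t = midRuns l t ∧ β t = lastRuns l t :=
        fun t ht => ⟨(hlr t ht).1.symm, (hlr t ht).2.symm⟩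
      have hR' := hR.congr hab
      have hP' : IsProfile l.length (midRuns l) (lastRuns l) :=
        isProfile_runs (fun t ht => by rw [← (hab t ht).1, ← (hab t ht).2]; exact hP.α_le_β t)
          (by rw [← (hab _ le_rfl).1, ← (hab _ le_rfl).2]; exact hP.α_eq_β)
      let g : GapWord l.length := ⟨⟨l, rfl⟩, (isMotzkinPath_reduceOption_iff l).2 hP'⟩
      have hlev : ∀ p ≤ l.length, level α β p = level (midRuns l) (lastRuns l) p := fun p hp =>
        level_congr hab hp
      have hflat : level α β l.length = g.flats := (hlev _ le_rfl).trans g.level_eq_flats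
      -- Directions are constant on levels, so any section of `lev` turns `ty` into a function of
      -- the level.
      choose inv hinv using g.lev_surjective
      let d : CycleData l.length r := ⟨g, ⟨τ, (g.mem_cutPerms_iff τ).2 ⟨hτ, fun t ht hbr => hcut t ht
        (by
          rwa [(hab t ht.le).1, (hab (t + 1) ht).1, (hab t ht.le).2, (hab (t + 1) ht).2])⟩⟩,
        ty ∘ inv, ⟨fun j => ⟨s j, by have := hle j; omega⟩, fun i j hij => hmono hij⟩⟩
      refine ⟨d, ?_⟩
      have hed : e d = e' := (he d).eq hR'
      have htyd : d.2.2.1 ∘ d.1.lev = ty := by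
        funext p
        refine hty _ _ ?_
        rw [hlev _ (by omega), hlev _ (by omega)]
        exact congrArg Fin.val (hinv (g.lev p))
      simp only [F, hed, htyd]
  rw [← hrange, ← Set.image_univ, Set.ncard_image_of_injective _ hinj, Set.ncard_univ]

theorem natCard_cycleData (M r : ℕ) : Nat.card (CycleData M r) =
    ∑ g : GapWord M, ((blocks g.1.toList).map catalan).prod *
      (2 ^ (g.flats + 1) * (r + g.flats + 1).choose r) := by
  rw [Nat.card_sigma]
  refine Finset.sum_congr rfl fun g _ => ?_
  rw [Nat.card_prod, Nat.card_prod, natCard_monotone, Nat.card_coe_set_eq, ← ncard_cutPerms,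
    sum_blocks, g.1.toList_length]
  simp [Nat.add_assoc]

/-- A word of length `K` has at most `K` flats at level zero, so the range of `l = flats + 2`
catches every Motzkin path exactly once. -/
theorem sum_motzkinNumber (K : ℕ) (c : ℕ → ℕ) :
    ∑ l ∈ Finset.Icc 2 (K + 2), c l * motzkinNumber K (l - 2) =
      ∑ w : List.Vector MotzkinStep K, open Classical in
        if IsMotzkinPath w.toList then c (flatsAtLevelZero w.toList + 2) else 0 := by
  classical
  rw [← Finset.sum_filter, ← Finset.sum_fiberwise_of_maps_to (t := Finset.Icc 2 (K + 2))
    (g := fun w : List.Vector MotzkinStep K => flatsAtLevelZero w.toList + 2)]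
  · refine Finset.sum_congr rfl fun l hl => ?_
    have hl := Finset.mem_Icc.1 hl
    rw [Finset.sum_congr rfl (g := fun _ => c l) fun w hw => by rw [(Finset.mem_filter.1 hw).2],
      Finset.sum_const, smul_eq_mul, Nat.mul_comm, motzkinNumber]
    congr 1
    have hinj : Function.Injective (List.Vector.toList (α := MotzkinStep) (n := K)) :=
      Subtype.val_injective
    rw [← Set.ncard_coe_finset, ← Set.ncard_image_of_injective _ hinj]
    congr 1
    ext w
    simp only [Set.mem_ofPred_eq, Set.mem_image, Finset.coe_filter, Finset.mem_filter,
      Finset.mem_univ, true_and]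
    constructor
    · rintro ⟨h1, h2, h3⟩
      exact ⟨⟨w, h1⟩, ⟨h2, by change flatsAtLevelZero w + 2 = l; omega⟩, rfl⟩
    · rintro ⟨w, ⟨h2, h3⟩, rfl⟩
      exact ⟨w.toList_length, h2, by omega⟩
  · intro w _
    have := flatsAtLevelZero_le w.toList
    rw [w.toList_length] at this
    exact Finset.mem_Icc.2 ⟨by omega, by omega⟩

theorem sum_cycleData (M r : ℕ) :
    ∑ k ∈ Finset.Icc 1 (M + 1), ∑ l ∈ Finset.Icc 2 (k + 1),
        2 ^ (l - 1) * (r + l - 1).choose r * motzkinNumber (k - 1) (l - 2) *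
          ∑ X : Composition (M + 1) with X.length = k, (X.blocks.map catalan).prod =
      Nat.card (CycleData M r) := by
  classical
  let c : ℕ → ℕ := fun l => 2 ^ (l - 1) * (r + l - 1).choose r
  let H : List ℕ → List MotzkinStep → ℕ := fun b w =>
    if IsMotzkinPath w then (b.map catalan).prod * c (flatsAtLevelZero w + 2) else 0
  have h1 : ∀ k ∈ Finset.Icc 1 (M + 1), ∑ l ∈ Finset.Icc 2 (k + 1),
        2 ^ (l - 1) * (r + l - 1).choose r * motzkinNumber (k - 1) (l - 2) *
          ∑ X : Composition (M + 1) with X.length = k, (X.blocks.map catalan).prod =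
      ∑ X : Composition (M + 1) with X.length = k,
        ∑ w : List.Vector MotzkinStep (X.length - 1), H X.blocks w.toList := by
    intro k hk
    have hk := Finset.mem_Icc.1 hk
    obtain ⟨K, rfl⟩ : ∃ K, k = K + 1 := ⟨k - 1, by omega⟩
    rw [← Finset.sum_mul, Nat.add_sub_cancel]
    rw [show K + 1 + 1 = K + 2 from rfl, sum_motzkinNumber K c, Finset.mul_sum]
    refine Finset.sum_congr rfl fun X hX => ?_
    rw [(Finset.mem_filter.1 hX).2, Finset.sum_mul]
    refine Finset.sum_congr rfl fun w _ => ?_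
    simp only [H]
    split
    · rw [Nat.mul_comm]
    · rw [Nat.zero_mul]
  rw [Finset.sum_congr rfl h1, Finset.sum_fiberwise_of_maps_to, sum_composition_words,
    natCard_cycleData]
  · rw [← Finset.sum_filter]
    rw [Finset.sum_subtype _ (p := fun g : List.Vector (Option MotzkinStep) M =>
      IsMotzkinPath g.toList.reduceOption) (by simp)]
    rfl
  · intro X _
    exact Finset.mem_Icc.2 ⟨X.length_pos_of_pos M.succ_pos, X.length_le⟩

end PermPattern

theorem mainTheorem3 (n m r : ℕ) (hm : 3 ≤ m) (hn : n = r + 3 * m) :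
    {π : Equiv.Perm (Fin n) |
        PermPattern.Avoids π PermPattern.p132 ∧
        PermPattern.CycleLengthsIn {1, 3} π ∧
        PermPattern.numCycles 1 π = r ∧
        PermPattern.numCycles 3 π = m}.ncard =
      ∑ k ∈ Finset.Icc 1 m, ∑ l ∈ Finset.Icc 2 (k + 1),
        2 ^ (l - 1) * (r + l - 1).choose r * PermPattern.motzkinNumber (k - 1) (l - 2) *
          ∑ X : Composition m with X.length = k, (X.blocks.map catalan).prod := by
  -- `M` is the number of gaps between consecutive cycles.
  obtain ⟨M, rfl⟩ : ∃ M, m = M + 1 := ⟨m - 1, by omega⟩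
  rw [PermPattern.sum_cycleData, ← PermPattern.ncard_threeCyclePerms hn]
  congr 1
  ext π
  exact and_congr (PermPattern.avoids_p132_iff π) (PermPattern.cycle_conditions_iff hn π)
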